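/- **Theorem (Maximum principle for minimal varifolds).** Let $N$ be a smooth $n$-dimensional Riemannian manifold with boundary, not necessarily complete, and let $\nu_N$ be the unit normal to $\partial N$ that points into $N$. Let $1\le m\le n-1$ and let $p\in\partial N$ be a point at which $N$ is strongly $m$-convex, i.e. $\kappa_1+\dots+\kappa_m>0$, where $\kappa_1\le\dots\le\kappa_{n-1}$ are the principal curvatures of $\partial N$ at $p$ with respect to $\nu_N$. An $m$-dimensional varifold $V$ in $N$ is a Radon measure on the bundle of pairs $(x,P)$, where $x\in N$ and $P$ is an $m$-dimensional linear subspace of $\operatorname{Tan}_xN$; its support $\operatorname{spt}V$ is the support of the image of this measure in $N$. A compactly supported $C^1$ tangent vectorfield $X$ on $N$ with $X\cdot\nu_N\ge 0$ along $\partial N$ generates maps $\phi_t:N\to N$ $(t\ge 0)$ with $\phi_0=\mathrm{id}$ and $\frac{d}{dt}\phi_t=X\circ\phi_t$, and the first variation is $$\delta V(X)=\Big(\frac{d}{dt}\Big)_{t=0^+}\operatorname{area}(\phi_t(V\cap W)),$$ where $W$ is any open set with compact closure that contains the support of $X$, and $\operatorname{area}(\phi_t(V\cap W))=\int_{\{(x,P)\,:\,x\in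 W\}}J_P\phi_t(x)\,dV(x,P)$ is the mass of the push-forward under $\phi_t$ of the part of $V$ in $W$; here $J_P\phi_t(x)$ is the factor by which the differential of $\phi_t$ at $x$ multiplies $m$-dimensional area in $P$. The varifold $V$ minimizes area to first order in $N$ if $\delta V(X)\ge 0$ for every such $X$. Then $p\notin\operatorname{spt}V$ for every $m$-dimensional varifold $V$ in $N$ that minimizes area to first order in $N$. Indeed, there is an $\epsilon>0$ such that $$\operatorname{dist}(p,\operatorname{spt}V)\ge\epsilon$$ for all such varifolds $V$. -/

import Mathlib

open Bundle MeasureTheory Set Topology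
open scoped Manifold ContDiff

noncomputable section

namespace MinVarifold

section Planes

variable (n : ℕ) [NeZero n] (N : Type*) [TopologicalSpace N]
  [ChartedSpace (EuclideanHalfSpace n) N] (m : ℕ)

/-- A frame of `m` linearly independent tangent vectors at a point of the
`n`-manifold with boundary `N`. -/
structure TangentFrame where
  /-- the base point -/
  base : N
  /-- the tangent vectors -/
  vec : Fin m → TangentSpace (𝓡∂ n) base
  linearIndependent : LinearIndependent ℝ vec

/-- A point `(x, P)` of the Grassmann bundle `G_m(N)`: a point `x` of `N` together with an
`m`-dimensional linear subspace `P` of the tangent space of `N` at `x`. -/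
structure TangentPlane where
  /-- the base point -/
  base : N
  /-- the linear subspace of the tangent space -/
  plane : Submodule ℝ (TangentSpace (𝓡∂ n) base)
  finrank_eq : Module.finrank ℝ plane = m

variable {n N m}

/-- The plane spanned by a frame. -/
def TangentFrame.span (f : TangentFrame n N m) : TangentPlane n N m where
  base := f.base
  plane := Submodule.span ℝ (range f.vec)
  finrank_eq := by
    have h := finrank_span_eq_card f.linearIndependent
    rwa [Fintype.card_fin] at h

variable [IsManifold (𝓡∂ n) ∞ N]

/-- The bundle of `m`-frames is topologized as a subset of `N × (TN)^m`. -/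
instance instTopologicalSpaceTangentFrame : TopologicalSpace (TangentFrame n N m) :=
  TopologicalSpace.induced
    (fun f => (f.base, fun i => (⟨f.base, f.vec i⟩ : TangentBundle (𝓡∂ n) N)) :
      TangentFrame n N m → N × (Fin m → TangentBundle (𝓡∂ n) N)) instTopologicalSpaceProd

/-- The Grassmann bundle carries the quotient topology from the bundle of `m`-frames. -/
instance : TopologicalSpace (TangentPlane n N m) :=
  TopologicalSpace.coinduced TangentFrame.span instTopologicalSpaceTangentFrame

instance : MeasurableSpace (TangentPlane n N m) := borel _

instance : BorelSpace (TangentPlane n N m) := ⟨rfl⟩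

theorem TangentPlane.continuous_base :
    Continuous (TangentPlane.base : TangentPlane n N m → N) := by
  refine continuous_coinduced_dom.2 ?_
  have h : Continuous (fun f : TangentFrame n N m =>
      (f.base, fun i => (⟨f.base, f.vec i⟩ : TangentBundle (𝓡∂ n) N))) := continuous_induced_dom
  exact continuous_fst.comp h

variable (n N m) in
/-- An `m`-dimensional varifold in `N`: a Radon measure on the Grassmann bundle `G_m(N)`. -/
structure Varifold where
  /-- the underlying measure -/
  measure : Measure (TangentPlane n N m)
  regular : measure.Regular

/-- The weight measure `μ_V` on `N`. -/
def Varifold.weight [MeasurableSpace N] (V : Varifold n N m) : Measure N :=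
  V.measure.map TangentPlane.base

/-- The support `spt V`: the support of the weight measure. -/
def Varifold.spt [MeasurableSpace N] (V : Varifold n N m) : Set N :=
  V.weight.support

end Planes

section Riemannian

variable {n : ℕ} [NeZero n] {N : Type*} [TopologicalSpace N]
  [ChartedSpace (EuclideanHalfSpace n) N]

instance (x : N) : FiniteDimensional ℝ (TangentSpace (𝓡∂ n) x) :=
  inferInstanceAs (FiniteDimensional ℝ (EuclideanSpace ℝ (Fin n)))

/-- The coordinates of a tangent vector at `x` in the preferred chart at `x`. The chart takes
values in the half-space where the coordinate of index `0` is nonnegative. -/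
def chartCoord (x : N) : TangentSpace (𝓡∂ n) x →L[ℝ] EuclideanSpace ℝ (Fin n) :=
  mfderiv (𝓡∂ n) 𝓘(ℝ, EuclideanSpace ℝ (Fin n)) (extChartAt (𝓡∂ n) x) x

variable [RiemannianBundle (fun x : N => TangentSpace (𝓡∂ n) x)]

/-- At a boundary point `x`, the vector `ν` is the unit normal to the boundary pointing into
`N`: it has length one, it is orthogonal to all vectors tangent to the boundary, and it points
to the inside. -/
structure IsInwardUnitNormal (x : N) (ν : TangentSpace (𝓡∂ n) x) : Prop where
  norm_eq_one : ‖ν‖ = 1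
  orthogonal : ∀ v : TangentSpace (𝓡∂ n) x, chartCoord x v 0 = 0 → inner ℝ ν v = 0
  inward : 0 < chartCoord x ν 0

/-! ### First variation of area -/

section FirstVariation

variable [IsManifold (𝓡∂ n) ∞ N] {m : ℕ}

/-- The vector field `X` is of class `C^1`, has compact support, and satisfies `X · ν ≥ 0` along
the boundary. -/
structure IsAdmissible (X : ∀ x : N, TangentSpace (𝓡∂ n) x) : Prop where
  contMDiff : ContMDiff (𝓡∂ n) (𝓡∂ n).tangent 1
    (fun x => (⟨x, X x⟩ : TangentBundle (𝓡∂ n) N))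
  isCompact_support : IsCompact (closure {x : N | X x ≠ 0})
  inward : ∀ x ∈ (𝓡∂ n).boundary N, ∀ ν : TangentSpace (𝓡∂ n) x,
    IsInwardUnitNormal x ν → 0 ≤ inner ℝ (X x) ν

/-- The Jacobian of `f` on the tangent plane `S = (x, P)`, i.e. the factor by which `df_x`
multiplies the `m`-dimensional area in `P`: the square root of the Gram determinant of the images
of an orthonormal basis of `P`. -/
def jacobian (f : N → N) (S : TangentPlane n N m) : ℝ :=
  √(Matrix.gram ℝ (fun i => mfderiv (𝓡∂ n) (𝓡∂ n) f S.base
    (stdOrthonormalBasis ℝ S.plane i : TangentSpace (𝓡∂ n) S.base))).det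

/-- The area of the image under `f` of the part of `V` that lies in `W`, i.e. the total mass of
the push-forward `f_# (V ⌞ W)`. If `V` comes from a `C^1` submanifold and `f` is injective, then
this is the area of `f (V ∩ W)`. -/
def Varifold.areaImage (V : Varifold n N m) (f : N → N) (W : Set N) : ℝ :=
  ∫ S in {S : TangentPlane n N m | S.base ∈ W}, jacobian f S ∂V.measure

/-- `φ` is the one-parameter family `t ∈ [0, ∞) ↦ φ_t` of maps of `N` into itself generated by
the `C^1` vector field `X`. -/
structure IsFlow (X : ∀ x : N, TangentSpace (𝓡∂ n) x) (φ : ℝ → N → N) : Prop where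
  contMDiffOn : ContMDiffOn (𝓘(ℝ, ℝ).prod (𝓡∂ n)) (𝓡∂ n) 1
    (fun z : ℝ × N => φ z.1 z.2) (Ici 0 ×ˢ univ)
  zero : ∀ x, φ 0 x = x
  integralCurve : ∀ x, IsMIntegralCurveOn (fun t => φ t x) X (Ici 0)

/-- The first variation `δV(X)` exists and equals `d`: the (one-sided) derivative at `t = 0` of
the area of `φ_t (V ∩ W)` is `d`, where `φ` is generated by `X` and `W` is any open set with
compact closure that contains the support of `X`. -/
def Varifold.HasFirstVariation (V : Varifold n N m) (X : ∀ x : N, TangentSpace (𝓡∂ n) x)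
    (d : ℝ) : Prop :=
  ∃ φ : ℝ → N → N, IsFlow X φ ∧
    ∀ W : Set N, IsOpen W → IsCompact (closure W) → closure {x : N | X x ≠ 0} ⊆ W →
      HasDerivWithinAt (fun t => V.areaImage (φ t) W) d (Ici 0) 0

/-- `V` minimizes area to first order in `N`: `δV(X) ≥ 0` for every compactly supported `C^1`
vector field `X` on `N` with `X · ν ≥ 0` along the boundary. -/
def Varifold.MinimizesAreaToFirstOrder (V : Varifold n N m) : Prop :=
  ∀ X : ∀ x : N, TangentSpace (𝓡∂ n) x, IsAdmissible X →
    ∃ d : ℝ, V.HasFirstVariation X d ∧ 0 ≤ d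

end FirstVariation

/-! ### Principal curvatures of the boundary -/

/-- The metric coefficient `g(v, w)` of two constant coordinate fields, in the preferred chart
at `p`, as a function of the point `y` of the half-space. -/
def chartMetric (p : N) (v w y : EuclideanSpace ℝ (Fin n)) : ℝ :=
  inner ℝ
    (mfderivWithin 𝓘(ℝ, EuclideanSpace ℝ (Fin n)) (𝓡∂ n) (extChartAt (𝓡∂ n) p).symm
      (range (𝓡∂ n)) y v)
    (mfderivWithin 𝓘(ℝ, EuclideanSpace ℝ (Fin n)) (𝓡∂ n) (extChartAt (𝓡∂ n) p).symm
      (range (𝓡∂ n)) y w)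

/-- The derivative at `p`, in the direction `u`, of the metric coefficient `g(v, w)`. -/
def chartMetricDeriv (p : N) (u v w : EuclideanSpace ℝ (Fin n)) : ℝ :=
  fderivWithin ℝ (chartMetric p v w) (range (𝓡∂ n)) (extChartAt (𝓡∂ n) p p) u

/-- The Christoffel symbol of the first kind at `p`: the product `∇_u v · w` at `p`, for the
Levi-Civita connection and constant coordinate fields `u`, `v`, `w`. -/
def christoffel (p : N) (u v w : EuclideanSpace ℝ (Fin n)) : ℝ :=
  (chartMetricDeriv p u v w + chartMetricDeriv p v u w - chartMetricDeriv p w u v) / 2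

/-- The second fundamental form `B(u, v) = ∇_u v · ν` of the boundary at `p` with respect to the
unit normal `ν`. The boundary is a piece of a hyperplane in the chart, so that a vector `v`
tangent to it extends to a tangent field with constant coordinates. -/
def secondFundamentalForm (p : N) (ν u v : TangentSpace (𝓡∂ n) p) : ℝ :=
  christoffel p (chartCoord p u) (chartCoord p v) (chartCoord p ν)

/-- `κ_1 ≤ ⋯ ≤ κ_{n-1}` are the principal curvatures of the boundary at `p` with respect to the
unit normal that points into `N`: some orthonormal basis of the tangent space of the boundary
diagonalizes the second fundamental form, with diagonal entries `κ_i`. -/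
def IsPrincipalCurvatures (p : N) (κ : Fin (n - 1) → ℝ) : Prop :=
  Monotone κ ∧ ∃ ν : TangentSpace (𝓡∂ n) p, IsInwardUnitNormal p ν ∧
    ∃ e : Fin (n - 1) → TangentSpace (𝓡∂ n) p, Orthonormal ℝ e ∧
      (∀ i, chartCoord p (e i) 0 = 0) ∧
      ∀ i j, secondFundamentalForm p ν (e i) (e j) = if i = j then κ i else 0

/-- `N` is strongly `m`-convex at the boundary point `p`: `m ≤ n - 1` and
`κ_1 + ⋯ + κ_m > 0`. -/
def StronglyConvexAt (m : ℕ) (p : N) : Prop :=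
  ∃ hm : m ≤ n - 1, ∃ κ : Fin (n - 1) → ℝ, IsPrincipalCurvatures p κ ∧
    0 < ∑ i : Fin m, κ (Fin.castLE hm i)

end Riemannian

end MinVarifold

end

/-!
The proof constructs, near `p`, one admissible vector field `X` whose flow decreases the area of all
`m`-planes, and decreases it at a positive rate over a neighbourhood `B` of `p`. If the support of
`V` meets `B`, then the derivative of the area along the flow of `X` is negative, so `V` does not
minimize area to first order. Since `X` and `B` do not depend on `V`, this gives the uniform bound on
the distance.

In the preferred chart at `p`, with values in the half-space `{0 ≤ x 0}` and `ξ₀` the image of `p`,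
let `f ξ = ξ 0 + ε |ξ - ξ₀|²` and `X = (η - f)₊² ∇f`, the gradient being that of the metric. The set
`{f < η}` shrinks to `ξ₀` with `η`, so `X` has small support, and `∇f` points inwards near `ξ₀`. The
divergence of `X` along a plane `P` is `(η - f)₊² tr_P (Hess f) - 2 (η - f)₊ |df|_P|²`. At `ξ₀` and for
`P` tangent to the boundary, `-tr_P (Hess f)` is, up to a positive factor and an error of order `ε`,
the trace over `P` of the second fundamental form, which is at least `κ_1 + ⋯ + κ_m > 0` by Ky Fan's
inequality (`sum_castLE_le_sum_of_orthonormal`). For the remaining planes the second term wins: by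
compactness of the set of orthonormal frames, `tr_P (Hess f) - k |df|_P|²` is uniformly negative near
`ξ₀` for some `k` (`IsMetricOn.exists_hessian_bound`), and `2 / (η - f) ≥ k` once `η ≤ 2 / k`. The
result is `IsMetricOn.exists_contracting_field`.

The area estimate needs no differentiation under the integral over `V`. The differential of the flow
satisfies the linearized equation (`hasDerivWithinAt_fderiv_flow`), so the squared Jacobian on a plane
is the determinant of a Gram matrix whose logarithmic derivative is twice the divergence of `X` along
the transported plane. Hence the Jacobian is at most `1` everywhere and at most `exp (-c t)` over `B`
(`IsFlow.jacobian_le`), and integrating these inequalities bounds the derivative of the area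
(`Varifold.deriv_areaImage_le`).
-/

noncomputable section

namespace MinVarifold

/-! ### Determinants and traces -/

/-- The derivative of the determinant at the identity matrix is the trace. -/
theorem hasDerivAt_det_of_eq_one {ι : Type*} [Fintype ι] [DecidableEq ι]
    {U : ℝ → Matrix ι ι ℝ} {U' : Matrix ι ι ℝ} {t : ℝ}
    (hU : ∀ i j, HasDerivAt (fun s => U s i j) (U' i j) t) (h1 : U t = 1) :
    HasDerivAt (fun s => (U s).det) U'.trace t := by
  have h : HasDerivAt (fun s => ∑ σ : Equiv.Perm ι, ((Equiv.Perm.sign σ : ℤ) : ℝ) *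
      ∏ i, U s (σ i) i) (∑ σ : Equiv.Perm ι, ((Equiv.Perm.sign σ : ℤ) : ℝ) *
      ∑ i, (∏ j ∈ Finset.univ.erase i, U t (σ j) j) • U' (σ i) i) t := by
    refine HasDerivAt.fun_sum fun σ _ => HasDerivAt.const_mul _ ?_
    exact HasDerivAt.fun_finsetProd fun i _ => hU (σ i) i
  have hval : (∑ σ : Equiv.Perm ι, ((Equiv.Perm.sign σ : ℤ) : ℝ) *
      ∑ i, (∏ j ∈ Finset.univ.erase i, U t (σ j) j) • U' (σ i) i) = U'.trace := by
    rw [Finset.sum_eq_single 1]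
    · simp [h1, Matrix.trace]
    · intro σ _ hσ
      -- a nontrivial permutation moves a point different from `i`
      have : ∀ i, ∏ j ∈ Finset.univ.erase i, U t (σ j) j = 0 := by
        intro i
        obtain ⟨k, hk⟩ : ∃ k, σ k ≠ k := by
          by_contra! hc
          exact hσ (Equiv.ext hc)
        by_cases hki : k = i
        · refine Finset.prod_eq_zero (i := σ k) (by simp [← hki, hk]) ?_
          rw [h1, Matrix.one_apply_ne]
          exact fun h => hk (σ.injective h)
        · refine Finset.prod_eq_zero (i := k) (by simp [hki]) ?_
          rw [h1, Matrix.one_apply_ne hk]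
      simp [this]
    · simp
  rw [hval] at h
  simpa only [Matrix.det_apply'] using h

open scoped MatrixOrder Matrix.Norms.L2Operator in
/-- A path of positive semidefinite matrices starting at the identity, whose derivative has trace at
most `-2c` after every normalization of the matrix to the identity, has `det ≤ exp (-2ct)`. -/
theorem det_le_exp_of_trace_deriv_le {ι : Type*} [Fintype ι] [DecidableEq ι]
    {G G' : ℝ → Matrix ι ι ℝ} {c δ : ℝ} (hδ : 0 ≤ δ)
    (hcont : ∀ i j, ContinuousOn (fun s => G s i j) (Icc 0 δ))
    (hderiv : ∀ t ∈ Ioo 0 δ, ∀ i j, HasDerivAt (fun s => G s i j) (G' t i j) t)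
    (hpos : ∀ t ∈ Icc 0 δ, (G t).PosSemidef) (h0 : G 0 = 1)
    (htr : ∀ t ∈ Ioo 0 δ, ∀ M : Matrix ι ι ℝ, M * G t * M.transpose = 1 →
      (M * G' t * M.transpose).trace ≤ -2 * c) :
    (G δ).det ≤ Real.exp (-2 * c * δ) := by
  have hdet : ∀ t ∈ Ioo 0 δ, ∃ d, HasDerivAt (fun s => (G s).det) d t ∧
      d ≤ -2 * c * (G t).det := by
    intro t ht
    have hpt := hpos t (Ioo_subset_Icc_self ht)
    have hD : DifferentiableAt ℝ (fun s => (G s).det) t := by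
      simp only [Matrix.det_apply']
      refine DifferentiableAt.fun_sum fun σ _ => DifferentiableAt.const_mul ?_ _
      exact (HasDerivAt.fun_finsetProd fun i _ => hderiv t ht (σ i) i).differentiableAt
    by_cases hz : (G t).det = 0
    · have hmin : IsLocalMin (fun s => (G s).det) t := by
        filter_upwards [Icc_mem_nhds ht.1 ht.2] with s hs
        rw [hz]
        exact (hpos s hs).det_nonneg
      exact ⟨0, hmin.deriv_eq_zero ▸ hD.hasDerivAt, by simp [hz]⟩
    · obtain ⟨B, hB⟩ : ∃ B : Matrix ι ι ℝ, G t = B.transpose * B := by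
        obtain ⟨B, hB⟩ := CStarAlgebra.nonneg_iff_eq_star_mul_self.mp hpt.nonneg
        exact ⟨B, by simpa [Matrix.star_eq_conjTranspose] using hB⟩
      have hBdet : B.det ≠ 0 := by
        intro h; apply hz; rw [hB]; simp [h]
      have hBu : IsUnit B.det := isUnit_iff_ne_zero.2 hBdet
      set M := (B⁻¹).transpose with hM
      have hM1 : M * G t * M.transpose = 1 := by
        rw [hB, hM, Matrix.transpose_transpose, ← Matrix.mul_assoc, ← Matrix.transpose_mul,
          Matrix.mul_nonsing_inv _ hBu]
        simp [Matrix.mul_nonsing_inv _ hBu]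
      have hMdet : M.det ^ 2 * (G t).det = 1 := by
        have := congrArg Matrix.det hM1
        simp only [Matrix.det_mul, Matrix.det_transpose, Matrix.det_one] at this
        linarith
      have hU : HasDerivAt (fun s => (M * G s * M.transpose).det)
          (M * G' t * M.transpose).trace t := by
        refine hasDerivAt_det_of_eq_one (fun i j => ?_) hM1
        simp only [Matrix.mul_apply]
        refine HasDerivAt.fun_sum fun k _ => HasDerivAt.mul_const ?_ _
        exact HasDerivAt.fun_sum fun l _ => HasDerivAt.const_mul _ (hderiv t ht l k)
      simp only [Matrix.det_mul, Matrix.det_transpose] at hU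
      have hM0 : M.det ≠ 0 := by rintro h; simp [h] at hMdet
      have hM2 : 0 < M.det ^ 2 := by positivity
      refine ⟨(M.det ^ 2)⁻¹ * (M * G' t * M.transpose).trace, ?_, ?_⟩
      · have := hU.const_mul (M.det ^ 2)⁻¹
        refine this.congr_of_eventuallyEq (Filter.Eventually.of_forall fun s => ?_)
        field_simp
      · have : (G t).det = (M.det ^ 2)⁻¹ := by field_simp; linarith
        rw [this, mul_comm]
        exact mul_le_mul_of_nonneg_right (htr t ht M hM1) (by positivity)
  -- hence `exp (2ct) det (G t)` is nonincreasing
  have hanti : AntitoneOn (fun t => Real.exp (2 * c * t) * (G t).det) (Icc 0 δ) := by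
    have hder : ∀ t ∈ Ioo 0 δ, ∃ d, HasDerivAt (fun t => Real.exp (2 * c * t) * (G t).det) d t ∧
        d ≤ 0 := by
      intro t ht
      obtain ⟨d, hd, hle⟩ := hdet t ht
      have he : HasDerivAt (fun t => Real.exp (2 * c * t)) (Real.exp (2 * c * t) * (2 * c)) t := by
        simpa using ((hasDerivAt_id t).const_mul (2 * c)).exp
      refine ⟨_, he.mul hd, ?_⟩
      have := mul_le_mul_of_nonneg_left hle (Real.exp_pos (2 * c * t)).le
      linarith
    refine antitoneOn_of_deriv_nonpos (convex_Icc 0 δ) ?_ ?_ ?_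
    · refine ContinuousOn.mul (by fun_prop) ?_
      simp only [Matrix.det_apply']
      exact continuousOn_finsetSum _ fun σ _ => continuousOn_const.mul
        (continuousOn_finsetProd _ fun i _ => hcont _ _)
    · rw [interior_Icc]
      intro t ht
      obtain ⟨d, hd, _⟩ := hder t ht
      exact hd.differentiableAt.differentiableWithinAt
    · rw [interior_Icc]
      intro t ht
      obtain ⟨d, hd, hle⟩ := hder t ht
      rwa [hd.deriv]
  have h := hanti (left_mem_Icc.2 hδ) (right_mem_Icc.2 hδ) hδ
  simp only [mul_zero, Real.exp_zero, h0, Matrix.det_one, mul_one] at h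
  have hexp : Real.exp (-2 * c * δ) = (Real.exp (2 * c * δ))⁻¹ := by
    rw [← Real.exp_neg]; congr 1; ring
  rw [hexp, ← one_div, le_div_iff₀ (Real.exp_pos _)]
  linarith

/-- Ky Fan's inequality: the trace of a quadratic form, diagonal with nondecreasing entries `κ` in
an orthonormal basis, over an `m`-dimensional subspace is at least the sum of the `m` smallest
entries. -/
theorem sum_castLE_le_sum_of_orthonormal {F : Type*} [NormedAddCommGroup F] [InnerProductSpace ℝ F]
    {k m : ℕ} (hm : m ≤ k) (Q : F →ₗ[ℝ] F →ₗ[ℝ] ℝ) {κ : Fin k → ℝ} (hκ : Monotone κ)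
    {e : Fin k → F} (he : Orthonormal ℝ e) (hQ : ∀ i j, Q (e i) (e j) = if i = j then κ i else 0)
    {u : Fin m → F} (hu : Orthonormal ℝ u) (hspan : ∀ i, u i ∈ Submodule.span ℝ (range e)) :
    ∑ i, κ (Fin.castLE hm i) ≤ ∑ i, Q (u i) (u i) := by
  rcases Nat.eq_zero_or_pos m with rfl | hm0
  · simp
  have hrep : ∀ i, ∑ j, inner ℝ (e j) (u i) • e j = u i := by
    intro i
    obtain ⟨a, ha⟩ := (Submodule.mem_span_range_iff_exists_fun ℝ).1 (hspan i)
    have : ∀ j, inner ℝ (e j) (u i) = a j := by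
      intro j
      rw [← ha, he.inner_right_fintype]
    simp only [this, ha]
  have hQu : ∀ i, Q (u i) (u i) = ∑ j, κ j * inner ℝ (e j) (u i) ^ 2 := by
    intro i
    conv_lhs => rw [← hrep i]
    simp only [map_sum, map_smul, LinearMap.sum_apply, LinearMap.smul_apply, hQ, smul_eq_mul]
    refine Finset.sum_congr rfl fun j _ => ?_
    simp
    ring
  set T : Fin k → ℝ := fun j => ∑ i, inner ℝ (e j) (u i) ^ 2 with hT
  have hT1 : ∀ j, T j ≤ 1 := by
    intro j
    have := hu.sum_inner_products_le (e j) (s := Finset.univ)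
    rw [he.1 j] at this
    simp only [Real.norm_eq_abs, sq_abs, one_pow] at this
    simp only [hT]
    refine le_trans (le_of_eq ?_) this
    exact Finset.sum_congr rfl fun i _ => by rw [real_inner_comm]
  have hT0 : ∀ j, 0 ≤ T j := fun j => Finset.sum_nonneg fun i _ => sq_nonneg _
  have hTsum : ∑ j, T j = m := by
    simp only [hT]
    rw [Finset.sum_comm]
    have : ∀ i, ∑ j, inner ℝ (e j) (u i) ^ 2 = 1 := by
      intro i
      have h1 : inner ℝ (u i) (u i) = (1 : ℝ) := by
        rw [real_inner_self_eq_norm_sq, hu.1 i]; norm_num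
      rw [← h1]
      conv_rhs => rw [← hrep i]
      rw [he.inner_sum]
      simp [sq]
    simp [this]
  have hsum : ∑ i, Q (u i) (u i) = ∑ j, κ j * T j := by
    simp only [hQu, hT, Finset.mul_sum]
    rw [Finset.sum_comm]
  let a : Fin k := Fin.castLE hm ⟨m - 1, by omega⟩
  have hind : ∀ φ : Fin k → ℝ, ∑ i, φ (Fin.castLE hm i) = ∑ j, if j.1 < m then φ j else 0 := by
    intro φ
    rw [← Finset.sum_filter]
    refine Finset.sum_bij (fun i _ => Fin.castLE hm i) (by simp) (by simp) ?_ (by simp)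
    intro j hj
    exact ⟨⟨j, by simpa using hj⟩, by simp, by ext; simp⟩
  rw [hsum, hind]
  -- every term of `∑ (κ j - κ a) (T j - [j < m])` is nonnegative, and `∑ (T j - [j < m]) = 0`
  have key : 0 ≤ ∑ j, (κ j - κ a) * (T j - if j.1 < m then 1 else 0) := by
    refine Finset.sum_nonneg fun j _ => ?_
    split_ifs with hj
    · have : κ j ≤ κ a := hκ (by rw [Fin.le_def]; simp [a]; omega)
      nlinarith [hT1 j]
    · have : κ a ≤ κ j := hκ (by rw [Fin.le_def]; simp [a]; omega)
      have := hT0 j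
      simp only [sub_zero]
      nlinarith
  have hone : ∑ j : Fin k, (if j.1 < m then (1 : ℝ) else 0) = m := by
    rw [← hind (fun _ => 1)]; simp
  have expand : ∑ j, (κ j - κ a) * (T j - if j.1 < m then 1 else 0) =
      ∑ j, κ j * T j - (∑ j, if j.1 < m then κ j else 0) -
        κ a * (∑ j, T j - ∑ j : Fin k, (if j.1 < m then (1 : ℝ) else 0)) := by
    rw [← Finset.sum_sub_distrib, ← Finset.sum_sub_distrib, Finset.mul_sum,
      ← Finset.sum_sub_distrib]
    refine Finset.sum_congr rfl fun j _ => ?_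
    split_ifs <;> ring
  rw [expand, hTsum, hone] at key
  linarith

/-! ### The linearized flow equation -/

/-- Differentiation of an ordinary differential equation `∂ₜ u = F` with respect to a parameter
`s ∈ [0, 1]` at the end point `s = 0`: the derivative `∂ₛ u` satisfies `∂ₜ (∂ₛ u) = ∂ₛ F`. -/
theorem hasDerivWithinAt_paramDeriv {E : Type*} [NormedAddCommGroup E] [NormedSpace ℝ E]
    [CompleteSpace E] {δ : ℝ} {u F F' : ℝ → ℝ → E} {u' : ℝ → E}
    (hu : ∀ s ∈ Icc (0 : ℝ) 1, ∀ t ∈ Icc 0 δ, HasDerivWithinAt (fun t => u t s) (F t s) (Icc 0 δ) t)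
    (hF : ∀ t ∈ Icc 0 δ, ∀ s ∈ Icc (0 : ℝ) 1, HasDerivWithinAt (F t) (F' t s) (Icc 0 1) s)
    (hFc : ContinuousOn (Function.uncurry F) (Icc 0 δ ×ˢ Icc 0 1))
    (hF'c : ContinuousOn (Function.uncurry F') (Icc 0 δ ×ˢ Icc 0 1))
    (hu' : ∀ t ∈ Icc 0 δ, HasDerivWithinAt (u t) (u' t) (Icc 0 1) 0) {t : ℝ} (ht : t ∈ Icc 0 δ) :
    HasDerivWithinAt u' (F' t 0) (Icc 0 δ) t := by
  have hδ : 0 ≤ δ := ht.1.trans ht.2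
  have h01 : (0 : ℝ) ∈ Icc (0 : ℝ) 1 := ⟨le_rfl, zero_le_one⟩
  have hFcs : ∀ s ∈ Icc (0 : ℝ) 1, ContinuousOn (fun τ => F τ s) (Icc 0 δ) := fun s hs =>
    hFc.comp (f := fun τ => (τ, s)) (by fun_prop) fun τ hτ => ⟨hτ, hs⟩
  have hF'c0 : ContinuousOn (fun τ => F' τ 0) (Icc 0 δ) :=
    hF'c.comp (f := fun τ => (τ, (0 : ℝ))) (by fun_prop) fun τ hτ => ⟨hτ, h01⟩
  have hsub : ∀ t ∈ Icc 0 δ, uIcc 0 t ⊆ Icc 0 δ := fun t ht => by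
    rw [uIcc_of_le ht.1]; exact Icc_subset_Icc_right ht.2
  have hint : ∀ t ∈ Icc 0 δ, ∀ s ∈ Icc (0 : ℝ) 1, ∫ τ in (0 : ℝ)..t, F τ s = u t s - u 0 s := by
    intro t ht s hs
    have hss : Icc 0 t ⊆ Icc 0 δ := Icc_subset_Icc_right ht.2
    refine intervalIntegral.integral_eq_sub_of_hasDerivAt_of_le (f := fun τ => u τ s) ht.1 ?_ ?_ ?_
    · exact fun τ hτ => ((hu s hs τ (hss hτ)).mono hss).continuousWithinAt
    · intro τ hτ
      exact ((hu s hs τ (hss (Ioo_subset_Icc_self hτ))).mono hss).hasDerivAt (Icc_mem_nhds hτ.1 hτ.2)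
    · exact ((hFcs s hs).mono (hsub t ht)).intervalIntegrable
  obtain ⟨M, hM⟩ := (isCompact_Icc.prod isCompact_Icc).exists_bound_of_continuousOn hF'c
  have hlip : ∀ τ ∈ Icc 0 δ, ∀ s ∈ Icc (0 : ℝ) 1, ‖F τ s - F τ 0‖ ≤ M * ‖s - 0‖ := fun τ hτ s hs =>
    Convex.norm_image_sub_le_of_norm_hasDerivWithin_le (fun x hx => hF τ hτ x hx)
      (fun x hx => hM (τ, x) ⟨hτ, hx⟩) (convex_Icc 0 1) h01 hs
  have hdiff : Icc (0 : ℝ) 1 \ {0} = Ioc 0 1 := by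
    ext x; simp only [mem_sdiff, mem_Icc, mem_singleton_iff, mem_Ioc]
    constructor
    · rintro ⟨⟨h1, h2⟩, h3⟩; exact ⟨lt_of_le_of_ne h1 (Ne.symm h3), h2⟩
    · rintro ⟨h1, h2⟩; exact ⟨⟨h1.le, h2⟩, h1.ne'⟩
  have hne : (𝓝[Ioc (0 : ℝ) 1] 0).NeBot := left_nhdsWithin_Ioc_neBot zero_lt_one
  have heq : ∀ t ∈ Icc 0 δ, u' t = u' 0 + ∫ τ in (0 : ℝ)..t, F' τ 0 := by
    intro t ht
    have h1 := hasDerivWithinAt_iff_tendsto_slope.1 (hu' t ht)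
    have h0 := hasDerivWithinAt_iff_tendsto_slope.1 (hu' 0 ⟨le_rfl, hδ⟩)
    rw [hdiff] at h1 h0
    have hlim : Filter.Tendsto (fun s => ∫ τ in (0 : ℝ)..t, slope (F τ) 0 s) (𝓝[Ioc (0 : ℝ) 1] 0)
        (𝓝 (∫ τ in (0 : ℝ)..t, F' τ 0)) := by
      refine intervalIntegral.tendsto_integral_filter_of_dominated_convergence (fun _ => M)
        ?_ ?_ (by simp) ?_
      · filter_upwards [self_mem_nhdsWithin] with s hs
        have hs' : s ∈ Icc (0 : ℝ) 1 := Ioc_subset_Icc_self hs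
        have : ContinuousOn (fun τ => slope (F τ) 0 s) (uIcc 0 t) := by
          simp only [slope_def_module]
          exact continuousOn_const.smul (((hFcs s hs').sub (hFcs 0 h01)).mono (hsub t ht))
        exact (this.mono uIoc_subset_uIcc).aestronglyMeasurable measurableSet_uIoc
      · filter_upwards [self_mem_nhdsWithin] with s hs
        refine Filter.Eventually.of_forall fun τ hτ => ?_
        have hτ' := hsub t ht (uIoc_subset_uIcc hτ)
        have := hlip τ hτ' s (Ioc_subset_Icc_self hs)
        rw [slope_def_module, norm_smul, norm_inv]
        have hs0 : 0 < ‖s - 0‖ := by simpa using hs.1.ne'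
        rw [inv_mul_le_iff₀ hs0]
        linarith
      · refine Filter.Eventually.of_forall fun τ hτ => ?_
        have hτ' := hsub t ht (uIoc_subset_uIcc hτ)
        have := hasDerivWithinAt_iff_tendsto_slope.1 (hF τ hτ' 0 h01)
        rwa [hdiff] at this
    have hev : (fun s => ∫ τ in (0 : ℝ)..t, slope (F τ) 0 s) =ᶠ[𝓝[Ioc (0 : ℝ) 1] 0]
        fun s => slope (u t) 0 s - slope (u 0) 0 s := by
      filter_upwards [self_mem_nhdsWithin] with s hs
      have hs' : s ∈ Icc (0 : ℝ) 1 := Ioc_subset_Icc_self hs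
      simp only [slope_def_module]
      rw [intervalIntegral.integral_smul, intervalIntegral.integral_sub
        ((hFcs s hs').mono (hsub t ht)).intervalIntegrable
        ((hFcs 0 h01).mono (hsub t ht)).intervalIntegrable, hint t ht s hs', hint t ht 0 h01,
        ← smul_sub]
      congr 1
      abel
    have := tendsto_nhds_unique (hlim.congr' hev) (h1.sub h0)
    rw [this]; abel
  -- extend the integrand continuously to the line and apply the fundamental theorem of calculus
  set h : ℝ → E := IccExtend hδ ((Icc 0 δ).domRestrict fun τ => F' τ 0) with hh
  have hc : Continuous h := (continuousOn_iff_continuous_domRestrict.1 hF'c0).Icc_extend'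
  have hhe : ∀ τ ∈ Icc 0 δ, h τ = F' τ 0 := fun τ hτ => by
    rw [hh, IccExtend_of_mem _ _ hτ]; rfl
  have hder : HasDerivAt (fun t => u' 0 + ∫ τ in (0 : ℝ)..t, h τ) (h t) t :=
    (intervalIntegral.integral_hasDerivAt_right (hc.intervalIntegrable _ _)
      (hc.stronglyMeasurableAtFilter _ _) hc.continuousAt).const_add _
  rw [hhe t ht] at hder
  have heq2 : ∀ t ∈ Icc 0 δ, u' t = u' 0 + ∫ τ in (0 : ℝ)..t, h τ := fun t ht => by
    rw [heq t ht]
    congr 1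
    exact intervalIntegral.integral_congr fun τ hτ => (hhe τ (hsub t ht hτ)).symm
  exact hder.hasDerivWithinAt.congr heq2 (heq2 t ht)

/-- The linearized flow equation: the spatial derivative `DΦ` of the flow of a vector field `X`
satisfies `∂ₜ (DΦ v) = DX (DΦ v)`. The flow lives on a convex set, and `v` points into it. -/
theorem hasDerivWithinAt_fderiv_flow {E : Type*} [NormedAddCommGroup E] [NormedSpace ℝ E]
    [CompleteSpace E] {δ : ℝ} {s₂ s₃ : Set E} {X : E → E} {DX : E → E →L[ℝ] E}
    {Φ : ℝ → E → E} {DΦ : ℝ → E → E →L[ℝ] E}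
    (hX : ∀ ξ ∈ s₃, HasFDerivWithinAt X (DX ξ) s₃ ξ) (hDX : ContinuousOn DX s₃)
    (hs : Convex ℝ s₂) (hmaps : ∀ t ∈ Icc 0 δ, MapsTo (Φ t) s₂ s₃)
    (hΦ : ContinuousOn (Function.uncurry Φ) (Icc 0 δ ×ˢ s₂))
    (hΦ' : ∀ t ∈ Icc 0 δ, ∀ ξ ∈ s₂, HasFDerivWithinAt (Φ t) (DΦ t ξ) s₂ ξ)
    (hDΦ : ContinuousOn (Function.uncurry DΦ) (Icc 0 δ ×ˢ s₂))
    (hflow : ∀ ξ ∈ s₂, ∀ t ∈ Icc 0 δ,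
      HasDerivWithinAt (fun t => Φ t ξ) (X (Φ t ξ)) (Icc 0 δ) t)
    {ξ v : E} (hξ : ξ ∈ s₂) (hv : ξ + v ∈ s₂) {t : ℝ} (ht : t ∈ Icc 0 δ) :
    HasDerivWithinAt (fun t => DΦ t ξ v) (DX (Φ t ξ) (DΦ t ξ v)) (Icc 0 δ) t := by
  have hseg : ∀ s ∈ Icc (0 : ℝ) 1, ξ + s • v ∈ s₂ := fun s hs' => by
    simpa using hs.add_smul_sub_mem hξ hv hs'
  have hline : ∀ s ∈ Icc (0 : ℝ) 1, HasDerivWithinAt (fun s : ℝ => ξ + s • v) v (Icc 0 1) s :=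
    fun s _ => by
      simpa using (((hasDerivAt_id s).smul_const v).const_add ξ).hasDerivWithinAt
  have hu : ∀ t ∈ Icc 0 δ, ∀ s ∈ Icc (0 : ℝ) 1,
      HasDerivWithinAt (fun s : ℝ => Φ t (ξ + s • v)) (DΦ t (ξ + s • v) v) (Icc 0 1) s :=
    fun t ht s hs' => (hΦ' t ht _ (hseg s hs')).comp_hasDerivWithinAt s (hline s hs') hseg
  have hmc : MapsTo (fun q : ℝ × ℝ => (q.1, ξ + q.2 • v)) (Icc 0 δ ×ˢ Icc 0 1)
      (Icc 0 δ ×ˢ s₂) := fun q hq => ⟨hq.1, hseg q.2 hq.2⟩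
  have hΦc : ContinuousOn (fun q : ℝ × ℝ => Φ q.1 (ξ + q.2 • v)) (Icc 0 δ ×ˢ Icc 0 1) :=
    hΦ.comp (f := fun q : ℝ × ℝ => (q.1, ξ + q.2 • v)) (by fun_prop) hmc
  have hDΦc : ContinuousOn (fun q : ℝ × ℝ => DΦ q.1 (ξ + q.2 • v)) (Icc 0 δ ×ˢ Icc 0 1) :=
    hDΦ.comp (f := fun q : ℝ × ℝ => (q.1, ξ + q.2 • v)) (by fun_prop) hmc
  have hm3 : MapsTo (fun q : ℝ × ℝ => Φ q.1 (ξ + q.2 • v)) (Icc 0 δ ×ˢ Icc 0 1) s₃ :=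
    fun q hq => hmaps q.1 hq.1 (hseg q.2 hq.2)
  have := hasDerivWithinAt_paramDeriv (δ := δ) (u := fun t s => Φ t (ξ + s • v))
    (F := fun t s => X (Φ t (ξ + s • v)))
    (F' := fun t s => DX (Φ t (ξ + s • v)) (DΦ t (ξ + s • v) v))
    (u' := fun t => DΦ t ξ v) (t := t)
    (fun s hs' t ht => hflow _ (hseg s hs') t ht)
    (fun t ht s hs' => (hX _ (hmaps t ht (hseg s hs'))).comp_hasDerivWithinAt s (hu t ht s hs')
      fun s hs' => hmaps t ht (hseg s hs'))
    ((show ContinuousOn X s₃ from fun ξ hξ => (hX ξ hξ).continuousWithinAt).comp hΦc hm3)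
    ((hDX.comp hΦc hm3).clm_apply (hDΦc.clm_apply continuousOn_const))
    (fun t ht => by simpa using hu t ht 0 ⟨le_rfl, zero_le_one⟩) ht
  simpa using this

/-! ### Metrics on a vector space -/

section LocalMetric

variable {E : Type*} [NormedAddCommGroup E] [InnerProductSpace ℝ E]

/-- `g` is a Riemannian metric of class `C^1` on the subset `U` of a vector space. -/
structure IsMetricOn (g : E → E →L[ℝ] E →L[ℝ] ℝ) (U : Set E) : Prop where
  contDiffOn : ContDiffOn ℝ 1 g U
  symm : ∀ ξ ∈ U, ∀ v w, g ξ v w = g ξ w v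
  pos : ∀ ξ ∈ U, ∀ v, v ≠ 0 → 0 < g ξ v v

/-- The family `u` is orthonormal for the bilinear form `b`. -/
def IsFrame {ι : Type*} [DecidableEq ι] (b : E →L[ℝ] E →L[ℝ] ℝ) (u : ι → E) : Prop :=
  ∀ i j, b (u i) (u j) = if i = j then 1 else 0

/-- The Christoffel symbols of the first kind of the metric `g` on `U`. -/
def christoffelOn (g : E → E →L[ℝ] E →L[ℝ] ℝ) (U : Set E) (ξ u v w : E) : ℝ :=
  (fderivWithin ℝ g U ξ u v w + fderivWithin ℝ g U ξ v u w - fderivWithin ℝ g U ξ w u v) / 2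

/-- The quadratic form `½ (L_X g) (u, u)` on `U`. Its trace over an orthonormal frame of a plane is
the divergence of `X` along that plane. -/
def halfLieDeriv (g : E → E →L[ℝ] E →L[ℝ] ℝ) (U : Set E) (X : E → E) (ξ u : E) : ℝ :=
  1 / 2 * fderivWithin ℝ g U ξ (X ξ) u u + g ξ (fderivWithin ℝ X U ξ u) u

/-- The vector dual to the covector `α` with respect to the metric `g` at `ξ`. -/
def metricGrad (g : E → E →L[ℝ] E →L[ℝ] ℝ) (α : E → E →L[ℝ] ℝ) (ξ : E) : E :=
  (g ξ).inverse (α ξ)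

namespace IsMetricOn

variable {g : E → E →L[ℝ] E →L[ℝ] ℝ} {U : Set E}

theorem mono (hg : IsMetricOn g U) {V : Set E} (h : V ⊆ U) : IsMetricOn g V :=
  ⟨hg.contDiffOn.mono h, fun ξ hξ => hg.symm ξ (h hξ), fun ξ hξ => hg.pos ξ (h hξ)⟩

variable [FiniteDimensional ℝ E]

theorem exists_equiv (hg : IsMetricOn g U) {ξ : E} (hξ : ξ ∈ U) :
    ∃ e : E ≃L[ℝ] (E →L[ℝ] ℝ), (e : E →L[ℝ] E →L[ℝ] ℝ) = g ξ := by
  have hinj : Function.Injective (g ξ) := by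
    rw [injective_iff_map_eq_zero]
    intro v hv
    by_contra h
    have := hg.pos ξ hξ v h
    simp [hv] at this
  have hfin : Module.finrank ℝ E = Module.finrank ℝ (E →L[ℝ] ℝ) :=
    (InnerProductSpace.toDual ℝ E).toLinearEquiv.finrank_eq
  refine ⟨(LinearEquiv.ofInjectiveOfFinrankEq (g ξ).toLinearMap hinj hfin).toContinuousLinearEquiv,
    ?_⟩
  ext v w
  rfl

theorem apply_metricGrad (hg : IsMetricOn g U) {ξ : E} (hξ : ξ ∈ U) (α : E → E →L[ℝ] ℝ) :
    g ξ (metricGrad g α ξ) = α ξ := by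
  obtain ⟨e, he⟩ := hg.exists_equiv hξ
  rw [metricGrad, ← he, ContinuousLinearMap.inverse_equiv]
  simp

theorem contDiffOn_metricGrad (hg : IsMetricOn g U) {α : E → E →L[ℝ] ℝ}
    (hα : ContDiffOn ℝ 1 α U) : ContDiffOn ℝ 1 (metricGrad g α) U := by
  intro ξ hξ
  obtain ⟨e, he⟩ := hg.exists_equiv hξ
  have h1 : ContDiffWithinAt ℝ 1 (fun ξ => (g ξ).inverse) U ξ := by
    have h := contDiffAt_map_inverse (𝕜 := ℝ) (n := 1) e
    rw [he] at h
    exact h.comp_contDiffWithinAt ξ (hg.contDiffOn ξ hξ)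
  exact h1.clm_apply (hα ξ hξ)

/-- Orthonormal frames over a compact set form a compact set. -/
theorem isCompact_frames (hg : IsMetricOn g U) {K : Set E} (hK : IsCompact K) (hKU : K ⊆ U)
    (ι : Type*) [Fintype ι] [DecidableEq ι] :
    IsCompact {q : E × (ι → E) | q.1 ∈ K ∧ IsFrame (g q.1) q.2} := by
  obtain ⟨a, ha, hle⟩ : ∃ a > 0, ∀ ξ ∈ K, ∀ v, ‖v‖ = 1 → a ≤ g ξ v v := by
    have hc : ContinuousOn (fun q : E × E => g q.1 q.2 q.2) (K ×ˢ Metric.sphere 0 1) :=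
      ((((hg.contDiffOn.continuousOn.mono hKU).comp continuousOn_fst fun q hq => hq.1).clm_apply
        continuousOn_snd).clm_apply continuousOn_snd)
    rcases (K ×ˢ Metric.sphere (0 : E) 1).eq_empty_or_nonempty with he | hne
    · refine ⟨1, one_pos, fun ξ hξ v hv => ?_⟩
      have : (ξ, v) ∈ K ×ˢ Metric.sphere (0 : E) 1 := ⟨hξ, by simpa using hv⟩
      rw [he] at this
      exact this.elim
    · obtain ⟨q, hq, hmin⟩ := (hK.prod (isCompact_sphere (0 : E) 1)).exists_isMinOn hne hc
      have hq2 : ‖q.2‖ = 1 := by simpa using hq.2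
      refine ⟨g q.1 q.2 q.2, hg.pos _ (hKU hq.1) _ fun h => by simp [h] at hq2, ?_⟩
      intro ξ hξ v hv
      exact hmin (show (ξ, v) ∈ _ from ⟨hξ, by simpa using hv⟩)
  have hle' : ∀ ξ ∈ K, ∀ v, a * ‖v‖ ^ 2 ≤ g ξ v v := by
    intro ξ hξ v
    rcases eq_or_ne v 0 with rfl | hv
    · simp
    · have := hle ξ hξ (‖v‖⁻¹ • v) (norm_smul_inv_norm hv)
      simp only [map_smul, _root_.smul_apply, smul_eq_mul] at this
      have hv' : 0 < ‖v‖ := norm_pos_iff.2 hv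
      calc a * ‖v‖ ^ 2 ≤ (‖v‖⁻¹ * (‖v‖⁻¹ * g ξ v v)) * ‖v‖ ^ 2 := by gcongr
        _ = g ξ v v := by field_simp
  set B : Set (E × (ι → E)) := K ×ˢ Metric.closedBall 0 (√(1 / a)) with hB
  have hBc : IsCompact B := hK.prod (isCompact_closedBall _ _)
  have hcont : ContinuousOn (fun q : E × (ι → E) => fun i j => g q.1 (q.2 i) (q.2 j)) B := by
    refine continuousOn_pi.2 fun i => continuousOn_pi.2 fun j => ?_
    exact (((hg.contDiffOn.continuousOn.mono hKU).comp continuousOn_fst fun q hq => hq.1).clm_apply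
        (by fun_prop)).clm_apply (by fun_prop)
  have hcl := hcont.preimage_isClosed_of_isClosed hBc.isClosed
    (isClosed_singleton (x := fun i j : ι => if i = j then (1 : ℝ) else 0))
  convert hBc.of_isClosed_subset hcl inter_subset_left using 1
  ext q
  constructor
  · rintro ⟨h1, h2⟩
    refine ⟨⟨h1, ?_⟩, by funext i j; exact h2 i j⟩
    rw [mem_closedBall_zero_iff, pi_norm_le_iff_of_nonneg (Real.sqrt_nonneg _)]
    intro i
    have := hle' _ h1 (q.2 i)
    rw [h2 i i, if_pos rfl] at this
    apply Real.le_sqrt_of_sq_le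
    rw [le_div_iff₀ ha]
    linarith
  · rintro ⟨h1, h2⟩
    exact ⟨h1.1, fun i j => congrFun (congrFun h2 i) j⟩

set_option synthInstance.maxHeartbeats 200000 in
/-- For the metric gradient `Z` of `f`, with `α = df`, the form `½ L_Z g` is the Hessian of `f`, i.e. the
coordinate Hessian corrected by the Christoffel symbols. It suffices to differentiate `g Z = α`. -/
theorem halfLieDeriv_metricGrad (hg : IsMetricOn g U) (hU : UniqueDiffOn ℝ U)
    {α : E → E →L[ℝ] ℝ} (hα : ContDiffOn ℝ 1 α U) {ξ : E} (hξ : ξ ∈ U) (u : E) :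
    halfLieDeriv g U (metricGrad g α) ξ u =
      fderivWithin ℝ α U ξ u u - christoffelOn g U ξ u u (metricGrad g α ξ) := by
  set Z := metricGrad g α with hZ
  have hgd : HasFDerivWithinAt g (fderivWithin ℝ g U ξ) U ξ :=
    (hg.contDiffOn.differentiableOn one_ne_zero ξ hξ).hasFDerivWithinAt
  have hZd : HasFDerivWithinAt Z (fderivWithin ℝ Z U ξ) U ξ :=
    ((hg.contDiffOn_metricGrad hα).differentiableOn one_ne_zero ξ hξ).hasFDerivWithinAt
  have hαd : HasFDerivWithinAt α (fderivWithin ℝ α U ξ) U ξ :=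
    (hα.differentiableOn one_ne_zero ξ hξ).hasFDerivWithinAt
  have h1 := hgd.clm_apply hZd
  have h2 := hαd.congr (fun y hy => hg.apply_metricGrad hy α) (hg.apply_metricGrad hξ α)
  have h3 := (hU ξ hξ).eq h1 h2
  have h4 := congrArg (fun T : E →L[ℝ] E →L[ℝ] ℝ => T u u) h3
  simp only [_root_.add_apply, ContinuousLinearMap.comp_apply,
    ContinuousLinearMap.flip_apply] at h4
  have hs : fderivWithin ℝ g U ξ u u (Z ξ) = fderivWithin ℝ g U ξ u (Z ξ) u := by
    have ha := (hgd.clm_apply (hasFDerivWithinAt_const u ξ U)).clm_apply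
      (hasFDerivWithinAt_const (Z ξ) ξ U)
    have hb := (hgd.clm_apply (hasFDerivWithinAt_const (Z ξ) ξ U)).clm_apply
      (hasFDerivWithinAt_const u ξ U)
    have hb' := hb.congr (fun y hy => hg.symm y hy u (Z ξ)) (hg.symm ξ hξ u (Z ξ))
    have := congrArg (fun T : E →L[ℝ] ℝ => T u) ((hU ξ hξ).eq ha hb')
    simpa using this
  rw [halfLieDeriv, christoffelOn, hs, ← h4]
  ring

end IsMetricOn

/-- The squared positive part is continuously differentiable. -/
theorem hasDerivAt_max_zero_sq (x : ℝ) :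
    HasDerivAt (fun x : ℝ => max x 0 ^ 2) (2 * max x 0) x := by
  rcases lt_trichotomy x 0 with h | rfl | h
  · rw [max_eq_right h.le]
    have : (fun x : ℝ => max x 0 ^ 2) =ᶠ[𝓝 x] fun _ => 0 := by
      filter_upwards [Iio_mem_nhds h] with y hy
      have hy' : y < 0 := hy
      simp [max_eq_right hy'.le]
    simpa using (hasDerivAt_const x (0 : ℝ)).congr_of_eventuallyEq this
  · rw [hasDerivAt_iff_isLittleO_nhds_zero]
    have : (fun h : ℝ => max (0 + h) 0 ^ 2 - max 0 0 ^ 2 - h • (2 * max (0 : ℝ) 0)) =O[𝓝 0]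
        fun h : ℝ => h ^ 2 := by
      refine Asymptotics.IsBigO.of_bound 1 (Filter.Eventually.of_forall fun h => ?_)
      rcases le_total h 0 with h0 | h0
      · simp [max_eq_right h0]; positivity
      · simp [max_eq_left h0]
    refine this.trans_isLittleO ?_
    simpa using Asymptotics.isLittleO_pow_id (𝕜 := ℝ) (n := 2) (by norm_num)
  · rw [max_eq_left h.le]
    have : (fun x : ℝ => max x 0 ^ 2) =ᶠ[𝓝 x] fun x => x ^ 2 := by
      filter_upwards [Ioi_mem_nhds h] with y hy
      have hy' : 0 < y := hy
      simp [max_eq_left hy'.le]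
    simpa using (hasDerivAt_pow 2 x).congr_of_eventuallyEq this

theorem contDiff_max_zero_sq : ContDiff ℝ 1 (fun x : ℝ => max x 0 ^ 2) := by
  rw [contDiff_one_iff_deriv]
  refine ⟨fun x => (hasDerivAt_max_zero_sq x).differentiableAt, ?_⟩
  have : deriv (fun x : ℝ => max x 0 ^ 2) = fun x => 2 * max x 0 :=
    funext fun x => (hasDerivAt_max_zero_sq x).deriv
  rw [this]
  fun_prop

end LocalMetric

/-! ### A vector field that contracts m-planes -/

section LocalField

variable {E : Type*} [NormedAddCommGroup E] [InnerProductSpace ℝ E]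

/-- The linear function `ℓ` bent upwards around the point `ξ₀`. Its sublevel sets in the half-space
`{0 ≤ ℓ}` shrink to `ξ₀`. -/
def bentFun (ℓ : E →L[ℝ] ℝ) (ξ₀ : E) (ε : ℝ) (ξ : E) : ℝ := ℓ ξ + ε * ‖ξ - ξ₀‖ ^ 2

/-- The differential of `bentFun`. -/
def bentDeriv (ℓ : E →L[ℝ] ℝ) (ξ₀ : E) (ε : ℝ) (ξ : E) : E →L[ℝ] ℝ :=
  ℓ + (2 * ε) • innerSL ℝ (ξ - ξ₀)

theorem hasFDerivAt_bentFun (ℓ : E →L[ℝ] ℝ) (ξ₀ : E) (ε : ℝ) (ξ : E) :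
    HasFDerivAt (bentFun ℓ ξ₀ ε) (bentDeriv ℓ ξ₀ ε ξ) ξ := by
  have h1 : HasFDerivAt (fun ξ => ξ - ξ₀) (ContinuousLinearMap.id ℝ E) ξ :=
    (hasFDerivAt_id ξ).sub_const ξ₀
  have h2 := (ℓ.hasFDerivAt (x := ξ)).add (h1.norm_sq.const_mul ε)
  refine HasFDerivAt.congr_fderiv (f := bentFun ℓ ξ₀ ε) h2 ?_
  ext v
  simp [bentDeriv, two_smul]
  ring

theorem contDiff_bentDeriv (ℓ : E →L[ℝ] ℝ) (ξ₀ : E) (ε : ℝ) : ContDiff ℝ 1 (bentDeriv ℓ ξ₀ ε) := by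
  have : ContDiff ℝ 1 fun ξ : E => innerSL ℝ (ξ - ξ₀) :=
    (innerSL ℝ).contDiff.comp (contDiff_id.sub contDiff_const)
  exact contDiff_const.add (this.const_smul (2 * ε))

theorem contDiff_bentFun (ℓ : E →L[ℝ] ℝ) (ξ₀ : E) (ε : ℝ) : ContDiff ℝ 1 (bentFun ℓ ξ₀ ε) :=
  ℓ.contDiff.add (contDiff_const.mul ((contDiff_id.sub contDiff_const).norm_sq ℝ))

theorem hasFDerivAt_bentDeriv (ℓ : E →L[ℝ] ℝ) (ξ₀ : E) (ε : ℝ) (ξ : E) :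
    HasFDerivAt (bentDeriv ℓ ξ₀ ε) ((2 * ε) • innerSL ℝ) ξ := by
  have h1 : HasFDerivAt (fun ξ => ξ - ξ₀) (ContinuousLinearMap.id ℝ E) ξ :=
    (hasFDerivAt_id ξ).sub_const ξ₀
  exact (((innerSL ℝ).hasFDerivAt.comp ξ h1).const_smul (2 * ε)).const_add ℓ

/-- The vector field `(η - f)₊² ∇f`, where `∇f` is the gradient of `f = bentFun ℓ ξ₀ ε` with respect
to the metric `g`. -/
def bentField (g : E → E →L[ℝ] E →L[ℝ] ℝ) (ℓ : E →L[ℝ] ℝ) (ξ₀ : E) (ε η : ℝ) (ξ : E) : E :=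
  max (η - bentFun ℓ ξ₀ ε ξ) 0 ^ 2 • metricGrad g (bentDeriv ℓ ξ₀ ε) ξ

variable [FiniteDimensional ℝ E] {g : E → E →L[ℝ] E →L[ℝ] ℝ} {U : Set E} {ℓ : E →L[ℝ] ℝ} {ξ₀ : E}

namespace IsMetricOn

theorem contDiffOn_bentField (hg : IsMetricOn g U) (ε η : ℝ) :
    ContDiffOn ℝ 1 (bentField g ℓ ξ₀ ε η) U :=
  ((contDiff_max_zero_sq.comp (contDiff_const.sub (contDiff_bentFun ℓ ξ₀ ε))).contDiffOn).smul
    (hg.contDiffOn_metricGrad (contDiff_bentDeriv ℓ ξ₀ ε).contDiffOn)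

set_option synthInstance.maxHeartbeats 200000 in
theorem halfLieDeriv_bentField (hg : IsMetricOn g U) (hU : UniqueDiffOn ℝ U) (ε η : ℝ) {ξ : E}
    (hξ : ξ ∈ U) (u : E) :
    halfLieDeriv g U (bentField g ℓ ξ₀ ε η) ξ u =
      max (η - bentFun ℓ ξ₀ ε ξ) 0 ^ 2 * (2 * ε * ‖u‖ ^ 2 -
        christoffelOn g U ξ u u (metricGrad g (bentDeriv ℓ ξ₀ ε) ξ)) -
      2 * max (η - bentFun ℓ ξ₀ ε ξ) 0 * bentDeriv ℓ ξ₀ ε ξ u ^ 2 := by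
  set α := bentDeriv ℓ ξ₀ ε with hα
  have hαc : ContDiffOn ℝ 1 α U := (contDiff_bentDeriv ℓ ξ₀ ε).contDiffOn
  have hα' : fderivWithin ℝ α U ξ u u = 2 * ε * ‖u‖ ^ 2 := by
    rw [(hasFDerivAt_bentDeriv ℓ ξ₀ ε ξ).hasFDerivWithinAt.fderivWithin (hU ξ hξ)]
    rw [_root_.smul_apply, _root_.smul_apply, innerSL_apply_apply, real_inner_self_eq_norm_sq,
      smul_eq_mul]
  have hlie := hg.halfLieDeriv_metricGrad hU hαc hξ u
  rw [hα'] at hlie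
  rw [← hlie]
  set b := max (η - bentFun ℓ ξ₀ ε ξ) 0 with hb
  have hψ : HasFDerivWithinAt (fun ξ => max (η - bentFun ℓ ξ₀ ε ξ) 0 ^ 2)
      ((2 * b) • (-α ξ)) U ξ :=
    (HasDerivAt.comp_hasFDerivAt (h₂ := fun x : ℝ => max x 0 ^ 2) ξ
      (hasDerivAt_max_zero_sq (η - bentFun ℓ ξ₀ ε ξ))
      ((hasFDerivAt_bentFun ℓ ξ₀ ε ξ).const_sub η)).hasFDerivWithinAt
  have hZ : HasFDerivWithinAt (metricGrad g α) (fderivWithin ℝ (metricGrad g α) U ξ) U ξ :=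
    ((hg.contDiffOn_metricGrad hαc).differentiableOn one_ne_zero ξ hξ).hasFDerivWithinAt
  have hX := (hψ.smul hZ).fderivWithin (hU ξ hξ)
  have hXv : fderivWithin ℝ (bentField g ℓ ξ₀ ε η) U ξ u =
      b ^ 2 • fderivWithin ℝ (metricGrad g α) U ξ u - (2 * b * α ξ u) • metricGrad g α ξ := by
    have := congrArg (fun T : E →L[ℝ] E => T u) hX
    simp only [_root_.add_apply, _root_.smul_apply, ContinuousLinearMap.smulRight_apply,
      _root_.neg_apply] at this
    refine Eq.trans this ?_
    rw [← hb, sub_eq_add_neg (b ^ 2 • _), ← neg_smul, smul_neg, smul_eq_mul]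
  have hXξ : bentField g ℓ ξ₀ ε η ξ = b ^ 2 • metricGrad g α ξ := rfl
  have hgZ : g ξ (metricGrad g α ξ) u = α ξ u := by rw [hg.apply_metricGrad hξ]
  rw [halfLieDeriv, halfLieDeriv, hXv, hXξ]
  simp only [map_smul, map_sub, _root_.smul_apply, _root_.sub_apply, smul_eq_mul, hgZ]
  ring

set_option synthInstance.maxHeartbeats 200000 in
/-- The trace over a frame of the Hessian of `bentFun` minus a multiple of the square of its
differential, the quantity that controls the divergence of `bentField`, is continuous in the frame. -/
theorem continuousOn_hessian_sub (hg : IsMetricOn g U) (hU : UniqueDiffOn ℝ U) (ε k : ℝ)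
    {m : ℕ} {K : Set E} (hKU : K ⊆ U) :
    ContinuousOn (fun q : E × (Fin m → E) => ∑ i, (2 * ε * ‖q.2 i‖ ^ 2 -
      christoffelOn g U q.1 (q.2 i) (q.2 i) (metricGrad g (bentDeriv ℓ ξ₀ ε) q.1) -
      k * bentDeriv ℓ ξ₀ ε q.1 (q.2 i) ^ 2)) (K ×ˢ univ) := by
  have hDg :=
    (hg.contDiffOn.continuousOn_fderivWithin hU le_rfl).mono hKU
  have hZ : ContinuousOn (metricGrad g (bentDeriv ℓ ξ₀ ε)) K :=
    (hg.contDiffOn_metricGrad (contDiff_bentDeriv ℓ ξ₀ ε).contDiffOn).continuousOn.mono hKU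
  have hf : MapsTo (Prod.fst : E × (Fin m → E) → E) (K ×ˢ univ) K := fun q hq => hq.1
  have hDg' := hDg.comp (continuousOn_fst (s := K ×ˢ (univ : Set (Fin m → E)))) hf
  have hZ' := hZ.comp (continuousOn_fst (s := K ×ˢ (univ : Set (Fin m → E)))) hf
  have hα' := ((contDiff_bentDeriv ℓ ξ₀ ε).continuous.comp
    (continuous_fst (X := E) (Y := Fin m → E))).continuousOn (s := K ×ˢ univ)
  have hu : ∀ i, ContinuousOn (fun q : E × (Fin m → E) => q.2 i) (K ×ˢ univ) := fun i => by fun_prop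
  refine continuousOn_finsetSum _ fun i _ => ?_
  refine ((continuousOn_const.mul ((hu i).norm.pow 2)).sub ?_).sub
    (continuousOn_const.mul ((hα'.clm_apply (hu i)).pow 2))
  refine ContinuousOn.div_const ?_ 2
  exact ((((hDg'.clm_apply (hu i)).clm_apply (hu i)).clm_apply hZ').add
    (((hDg'.clm_apply (hu i)).clm_apply (hu i)).clm_apply hZ')).sub
    (((hDg'.clm_apply hZ').clm_apply (hu i)).clm_apply (hu i))

/-- If the trace of `Γ(·, ·, ∇ℓ)` at `ξ₀` is positive on all `m`-planes tangent to `ker ℓ`, then,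
after bending `ℓ` slightly, its Hessian corrected by a large multiple of the squared differential
has uniformly negative trace on all `m`-planes near `ξ₀`. -/
theorem exists_hessian_bound (hg : IsMetricOn g U) (hU : UniqueDiffOn ℝ U) {R : ℝ} (hR : 0 < R)
    (hball : ∀ ξ, 0 ≤ ℓ ξ → dist ξ ξ₀ ≤ R → ξ ∈ U) (h0 : ℓ ξ₀ = 0) {m : ℕ}
    (hconv : ∀ u : Fin m → E, IsFrame (g ξ₀) u → (∀ i, ℓ (u i) = 0) →
      0 < ∑ i, christoffelOn g U ξ₀ (u i) (u i) (metricGrad g (fun _ => ℓ) ξ₀)) :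
    ∃ k > 0, ∃ c > 0, ∃ r > 0, r ≤ R ∧ ∀ ξ, 0 ≤ ℓ ξ → dist ξ ξ₀ < r →
      ∀ u : Fin m → E, IsFrame (g ξ) u →
        ∑ i, (2 * k⁻¹ * ‖u i‖ ^ 2 -
          christoffelOn g U ξ (u i) (u i) (metricGrad g (bentDeriv ℓ ξ₀ k⁻¹) ξ) -
          k * bentDeriv ℓ ξ₀ k⁻¹ ξ (u i) ^ 2) ≤ -c := by
  set K : Set E := {ξ | 0 ≤ ℓ ξ} ∩ Metric.closedBall ξ₀ R with hK
  have hKc : IsCompact K :=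
    (isCompact_closedBall ξ₀ R).inter_left (isClosed_le continuous_const ℓ.continuous)
  have hKU : K ⊆ U := fun ξ hξ => hball ξ hξ.1 hξ.2
  have hξ₀ : ξ₀ ∈ U := hball ξ₀ h0.ge (by simpa using hR.le)
  have hα₀ : ∀ ε, bentDeriv ℓ ξ₀ ε ξ₀ = ℓ := fun ε => by simp [bentDeriv]
  have hZ₀ : ∀ ε, metricGrad g (bentDeriv ℓ ξ₀ ε) ξ₀ = metricGrad g (fun _ => ℓ) ξ₀ := fun ε => by
    simp [metricGrad, hα₀]
  -- the frames at `ξ₀`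
  have hF₀ : IsCompact {u : Fin m → E | IsFrame (g ξ₀) u} := by
    have := (hg.isCompact_frames (isCompact_singleton (x := ξ₀)) (singleton_subset_iff.2 hξ₀)
      (Fin m)).image continuous_snd
    convert this using 1
    ext u
    simp
  set Φ : ℝ → E × (Fin m → E) → ℝ := fun k q => ∑ i, (2 * k⁻¹ * ‖q.2 i‖ ^ 2 -
      christoffelOn g U q.1 (q.2 i) (q.2 i) (metricGrad g (bentDeriv ℓ ξ₀ k⁻¹) q.1) -
      k * bentDeriv ℓ ξ₀ k⁻¹ q.1 (q.2 i) ^ 2) with hΦ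
  have hΦc : ∀ k, ContinuousOn (Φ k) (K ×ˢ univ) := fun k => hg.continuousOn_hessian_sub hU _ k hKU
  have hξK : ξ₀ ∈ K := ⟨h0.ge, by simpa using hR.le⟩
  have hΦc₀ : ∀ k, Continuous fun u : Fin m → E => Φ k (ξ₀, u) := fun k => by
    rw [← continuousOn_univ]
    exact (hΦc k).comp (f := fun u : Fin m → E => (ξ₀, u)) (by fun_prop) fun u _ => ⟨hξK, mem_univ _⟩
  obtain ⟨N, hN⟩ : ∃ N : ℕ, {u : Fin m → E | IsFrame (g ξ₀) u} ⊆
      {u | Φ ((N : ℝ) + 1) (ξ₀, u) < 0} := by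
    refine hF₀.elim_directed_cover _ (fun N => isOpen_lt (hΦc₀ _) continuous_const) ?_ ?_
    · intro u hu
      set A := ∑ i, christoffelOn g U ξ₀ (u i) (u i) (metricGrad g (fun _ => ℓ) ξ₀) with hA
      have hform : ∀ k, Φ k (ξ₀, u) = k⁻¹ * (2 * ∑ i, ‖u i‖ ^ 2) - A - k * ∑ i, ℓ (u i) ^ 2 := by
        intro k
        simp only [hΦ, hα₀, hZ₀, hA, Finset.sum_sub_distrib, Finset.mul_sum]
        congr 2
        exact Finset.sum_congr rfl fun i _ => by ring
      have hinv : Filter.Tendsto (fun N : ℕ => ((N : ℝ) + 1)⁻¹ * (2 * ∑ i, ‖u i‖ ^ 2))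
          Filter.atTop (𝓝 0) := by
        have := (tendsto_one_div_add_atTop_nhds_zero_nat (𝕜 := ℝ)).mul_const (2 * ∑ i, ‖u i‖ ^ 2)
        simpa using this
      have hq0 : 0 ≤ ∑ i, ℓ (u i) ^ 2 := Finset.sum_nonneg fun i _ => sq_nonneg _
      rw [mem_iUnion]
      simp only [mem_ofPred_eq, hform]
      rcases hq0.eq_or_lt with hq | hq
      · have hz : ∀ i, ℓ (u i) = 0 := by
          intro i
          have := (Finset.sum_eq_zero_iff_of_nonneg fun i _ => sq_nonneg (ℓ (u i))).1 hq.symm i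
            (Finset.mem_univ i)
          exact pow_eq_zero_iff two_ne_zero |>.1 this
        have hApos : 0 < A := hconv u hu hz
        obtain ⟨N, hN⟩ := (hinv.eventually (Iio_mem_nhds hApos)).exists
        have hN' : ((N : ℝ) + 1)⁻¹ * (2 * ∑ i, ‖u i‖ ^ 2) < A := hN
        exact ⟨N, by rw [← hq]; linarith⟩
      · have h2 : Filter.Tendsto (fun N : ℕ => ((N : ℝ) + 1) * ∑ i, ℓ (u i) ^ 2)
            Filter.atTop Filter.atTop :=
          (Filter.tendsto_atTop_add_const_right _ 1 tendsto_natCast_atTop_atTop).atTop_mul_const hq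
        obtain ⟨N, hN1, hN2⟩ := ((hinv.eventually (Iio_mem_nhds one_pos)).and
          (h2.eventually_ge_atTop (1 - A))).exists
        have hN1' : ((N : ℝ) + 1)⁻¹ * (2 * ∑ i, ‖u i‖ ^ 2) < 1 := hN1
        exact ⟨N, by linarith⟩
    · refine Monotone.directed_le fun N M hNM u hu => ?_
      have hle : ((N : ℝ) + 1) ≤ (M : ℝ) + 1 := by gcongr
      have hNpos : (0 : ℝ) < (N : ℝ) + 1 := by positivity
      refine lt_of_le_of_lt ?_ (show Φ ((N : ℝ) + 1) (ξ₀, u) < 0 from hu)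
      simp only [hΦ, hα₀, hZ₀]
      gcongr
  set k : ℝ := (N : ℝ) + 1 with hk
  have hkpos : 0 < k := by positivity
  obtain ⟨c, hc, hcb⟩ : ∃ c > 0, ∀ u : Fin m → E, IsFrame (g ξ₀) u → Φ k (ξ₀, u) < -c := by
    rcases {u : Fin m → E | IsFrame (g ξ₀) u}.eq_empty_or_nonempty with he | hne
    · refine ⟨1, one_pos, fun u hu => ?_⟩
      have : u ∈ {u : Fin m → E | IsFrame (g ξ₀) u} := hu
      rw [he] at this
      exact this.elim
    · obtain ⟨u₀, hu₀, hmax⟩ := hF₀.exists_isMaxOn hne (hΦc₀ k).continuousOn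
      have hneg : Φ k (ξ₀, u₀) < 0 := hN hu₀
      refine ⟨-Φ k (ξ₀, u₀) / 2, by linarith, fun u hu => ?_⟩
      have : Φ k (ξ₀, u) ≤ Φ k (ξ₀, u₀) := hmax hu
      linarith
  -- the base points carrying a frame that violates the bound form a closed set
  have hbad : IsCompact (Prod.fst '' ({q : E × (Fin m → E) | q.1 ∈ K ∧ IsFrame (g q.1) q.2} ∩
      Φ k ⁻¹' Ici (-c))) := by
    have hFc := hg.isCompact_frames hKc hKU (Fin m)
    refine IsCompact.image ?_ continuous_fst
    have hsub : {q : E × (Fin m → E) | q.1 ∈ K ∧ IsFrame (g q.1) q.2} ⊆ K ×ˢ univ :=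
      fun q hq => ⟨hq.1, mem_univ _⟩
    have hcl := ((hΦc k).mono hsub).preimage_isClosed_of_isClosed
      hFc.isClosed (isClosed_Ici (a := -c))
    exact hFc.of_isClosed_subset hcl inter_subset_left
  have hnot : ξ₀ ∉ Prod.fst '' ({q : E × (Fin m → E) | q.1 ∈ K ∧ IsFrame (g q.1) q.2} ∩
      Φ k ⁻¹' Ici (-c)) := by
    rintro ⟨⟨ξ, u⟩, ⟨⟨_, hu⟩, hge⟩, rfl⟩
    have hge' : -c ≤ Φ k (ξ, u) := hge
    exact absurd (hcb u hu) (not_lt.2 hge')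
  obtain ⟨r, hr, hrb⟩ := Metric.mem_nhds_iff.1 (hbad.isClosed.isOpen_compl.mem_nhds hnot)
  refine ⟨k, hkpos, c, hc, min r R, lt_min hr hR, min_le_right _ _, ?_⟩
  intro ξ hξ hd u hu
  by_contra hcon
  rw [not_le] at hcon
  exact hrb (Metric.mem_ball.2 (hd.trans_le (min_le_left _ _)))
    ⟨(ξ, u), ⟨⟨⟨hξ, (hd.trans_le (min_le_right _ _)).le⟩, hu⟩, hcon.le⟩, rfl⟩

/-- Under the convexity hypothesis of `exists_hessian_bound` there is, near `ξ₀`, a vector field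
supported in a small ball that does not point out of the half-space `{0 ≤ ℓ}`, and whose divergence
is nonpositive on all `m`-planes and uniformly negative on all `m`-planes near `ξ₀`. -/
theorem exists_contracting_field (hg : IsMetricOn g U) (hU : UniqueDiffOn ℝ U) {R : ℝ} (hR : 0 < R)
    (hball : ∀ ξ, 0 ≤ ℓ ξ → dist ξ ξ₀ ≤ R → ξ ∈ U) (hUℓ : ∀ ξ ∈ U, 0 ≤ ℓ ξ)
    (h0 : ℓ ξ₀ = 0) (hℓ : ℓ ≠ 0) {m : ℕ}
    (hconv : ∀ u : Fin m → E, IsFrame (g ξ₀) u → (∀ i, ℓ (u i) = 0) →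
      0 < ∑ i, christoffelOn g U ξ₀ (u i) (u i) (metricGrad g (fun _ => ℓ) ξ₀)) :
    ∃ X : E → E, ∃ r > 0, ∃ c > 0, ∃ r₀ > 0, 3 * r < R ∧ ContDiffOn ℝ 1 X U ∧
      (∀ ξ, 0 ≤ ℓ ξ → X ξ ≠ 0 → dist ξ ξ₀ ≤ r) ∧ (∀ ξ ∈ U, 0 ≤ ℓ (X ξ)) ∧
      ∀ ξ ∈ U, dist ξ ξ₀ < 3 * r → ∀ u : Fin m → E, IsFrame (g ξ) u →
        ∑ i, halfLieDeriv g U X ξ (u i) ≤ 0 ∧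
        (dist ξ ξ₀ < r₀ → ∑ i, halfLieDeriv g U X ξ (u i) ≤ -c) := by
  have hξ₀ : ξ₀ ∈ U := hball ξ₀ h0.ge (by simpa using hR.le)
  obtain ⟨k, hk, c, hc, r₁, hr₁, hr₁R, hbound⟩ := hg.exists_hessian_bound hU hR hball h0 hconv
  have hki : 0 < k⁻¹ := inv_pos.2 hk
  set f := bentFun ℓ ξ₀ k⁻¹ with hf
  set Z := metricGrad g (bentDeriv ℓ ξ₀ k⁻¹) with hZ
  have hZc : ContinuousOn Z U :=
    (hg.contDiffOn_metricGrad (contDiff_bentDeriv ℓ ξ₀ k⁻¹).contDiffOn).continuousOn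
  have hZpos : 0 < ℓ (Z ξ₀) := by
    have h1 : g ξ₀ (Z ξ₀) = ℓ := by
      rw [hZ, hg.apply_metricGrad hξ₀]; simp [bentDeriv]
    have hne : Z ξ₀ ≠ 0 := by
      intro h
      rw [h, map_zero] at h1
      exact hℓ h1.symm
    have := hg.pos ξ₀ hξ₀ _ hne
    rwa [h1] at this
  obtain ⟨r₂, hr₂, hZr⟩ : ∃ r₂ > 0, ∀ ξ ∈ U, dist ξ ξ₀ < r₂ → 0 < ℓ (Z ξ) := by
    have := (ℓ.continuous.comp_continuousOn hZc) ξ₀ hξ₀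
    have h2 := this.eventually (Ioi_mem_nhds hZpos)
    obtain ⟨r₂, hr₂, hsub⟩ := Metric.mem_nhdsWithin_iff.1 h2
    exact ⟨r₂, hr₂, fun ξ hξ hd => hsub ⟨hd, hξ⟩⟩
  set r := min (r₁ / 4) (r₂ / 2) with hr
  have hrpos : 0 < r := lt_min (by linarith) (by linarith)
  have hr1 : r ≤ r₁ / 4 := min_le_left _ _
  have hr2 : r ≤ r₂ / 2 := min_le_right _ _
  -- the sublevel set of height `η` lies in the ball of radius `r`, and `2 / η ≥ k`
  set η := min (2 / k) (k⁻¹ * r ^ 2) with hη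
  have hηpos : 0 < η := lt_min (by positivity) (by positivity)
  have hfnonneg : ∀ ξ ∈ U, 0 ≤ f ξ := fun ξ hξ => by
    have := hUℓ ξ hξ
    simp only [hf, bentFun]; positivity
  have hsupp : ∀ ξ, 0 ≤ ℓ ξ → f ξ < η → dist ξ ξ₀ ≤ r := by
    intro ξ hξ h
    have h1 : k⁻¹ * ‖ξ - ξ₀‖ ^ 2 ≤ k⁻¹ * r ^ 2 := by
      have h2 := min_le_right (2 / k) (k⁻¹ * r ^ 2)
      simp only [hf, bentFun] at h
      linarith
    rw [dist_eq_norm]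
    exact le_of_sq_le_sq (le_of_mul_le_mul_left h1 hki) hrpos.le
  have hf0 : f ξ₀ = 0 := by simp [hf, bentFun, h0]
  obtain ⟨r₀, hr₀, hfr⟩ : ∃ r₀ > 0, ∀ ξ, dist ξ ξ₀ < r₀ → f ξ < η / 2 := by
    have h1 : ∀ᶠ ξ in 𝓝 ξ₀, f ξ < η / 2 := by
      refine (contDiff_bentFun ℓ ξ₀ k⁻¹).continuous.continuousAt.eventually (Iio_mem_nhds ?_)
      rw [← hf, hf0]; linarith
    exact Metric.eventually_nhds_iff.1 h1
  refine ⟨bentField g ℓ ξ₀ k⁻¹ η, r, hrpos, c * (η / 2) ^ 2, by positivity, r₀, hr₀, by linarith,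
    hg.contDiffOn_bentField _ _, ?_, ?_, ?_⟩
  · intro ξ hξ hX
    refine hsupp ξ hξ ?_
    by_contra hcon
    apply hX
    have : max (η - f ξ) 0 = 0 := max_eq_right (by linarith)
    simp [bentField, ← hf, this]
  · intro ξ hξ
    rcases lt_or_ge (f ξ) η with h | h
    · have hpos := hZr ξ hξ ((hsupp ξ (hUℓ ξ hξ) h).trans_lt (by linarith))
      simp only [bentField, map_smul, smul_eq_mul]
      positivity
    · have : max (η - f ξ) 0 = 0 := max_eq_right (by linarith)
      simp [bentField, ← hf, this]
  · intro ξ hξ hd u hu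
    set b := max (η - f ξ) 0 with hb
    have hb0 : 0 ≤ b := le_max_right _ _
    have hbη : b ≤ η := max_le (by linarith [hfnonneg ξ hξ]) hηpos.le
    have hkb : k * b ≤ 2 := by
      have h1 : b ≤ 2 / k := hbη.trans (min_le_left _ _)
      calc k * b ≤ k * (2 / k) := by gcongr
        _ = 2 := by field_simp
    have hest : ∑ i, halfLieDeriv g U (bentField g ℓ ξ₀ k⁻¹ η) ξ (u i) ≤ b ^ 2 * -c := by
      refine le_trans ?_ (mul_le_mul_of_nonneg_left
        (hbound ξ (hUℓ ξ hξ) (hd.trans_le (by linarith)) u hu) (sq_nonneg b))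
      rw [Finset.mul_sum]
      refine Finset.sum_le_sum fun i _ => ?_
      rw [hg.halfLieDeriv_bentField hU _ _ hξ, ← hf, ← hb]
      have h3 : k * b * (b * bentDeriv ℓ ξ₀ k⁻¹ ξ (u i) ^ 2) ≤
          2 * (b * bentDeriv ℓ ξ₀ k⁻¹ ξ (u i) ^ 2) :=
        mul_le_mul_of_nonneg_right hkb (by positivity)
      linarith
    refine ⟨hest.trans (by nlinarith [sq_nonneg b]), fun hd₀ => hest.trans ?_⟩
    have h1 : η / 2 ≤ b := le_trans (by linarith [hfr ξ hd₀]) (le_max_left _ _)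
    have h2 : (η / 2) ^ 2 ≤ b ^ 2 := by gcongr
    nlinarith

end IsMetricOn

end LocalField

/-! ### Jacobians along a flow in coordinates -/

section LocalFlow

variable {E : Type*} [NormedAddCommGroup E] [InnerProductSpace ℝ E]

/-- The Gram matrix of the family `w` with respect to the bilinear form `b`. -/
def gramOf {ι : Type*} (b : E →L[ℝ] E →L[ℝ] ℝ) (w : ι → E) : Matrix ι ι ℝ :=
  Matrix.of fun i j => b (w i) (w j)

theorem mul_gramOf_mul_transpose {ι : Type*} [Fintype ι] (b : E →L[ℝ] E →L[ℝ] ℝ) (w : ι → E)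
    (M : Matrix ι ι ℝ) :
    M * gramOf b w * M.transpose = gramOf b fun i => ∑ k, M i k • w k := by
  ext i j
  simp only [Matrix.mul_apply, gramOf, Matrix.of_apply, Matrix.transpose_apply, map_sum, map_smul,
    _root_.sum_apply, _root_.smul_apply, smul_eq_mul, Finset.sum_mul, Finset.mul_sum]
  refine Finset.sum_congr rfl fun k _ => Finset.sum_congr rfl fun l _ => by ring

variable {g : E → E →L[ℝ] E →L[ℝ] ℝ} {U : Set E}

namespace IsMetricOn

theorem posSemidef_gramOf (hg : IsMetricOn g U) {ξ : E} (hξ : ξ ∈ U) {ι : Type*} [Fintype ι]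
    (w : ι → E) : (gramOf (g ξ) w).PosSemidef := by
  refine Matrix.PosSemidef.of_dotProduct_mulVec_nonneg ?_ fun x => ?_
  · ext i j
    simp [gramOf, hg.symm ξ hξ (w i) (w j)]
  · have : star x ⬝ᵥ (gramOf (g ξ) w).mulVec x = g ξ (∑ i, x i • w i) (∑ i, x i • w i) := by
      simp only [dotProduct, Matrix.mulVec, gramOf, Matrix.of_apply, map_sum, map_smul,
        _root_.sum_apply, _root_.smul_apply, smul_eq_mul, Finset.mul_sum, star_trivial]
      rw [Finset.sum_comm]
      refine Finset.sum_congr rfl fun k _ => Finset.sum_congr rfl fun l _ => by ring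
    rw [this]
    rcases eq_or_ne (∑ i, x i • w i) 0 with h | h
    · simp [h]
    · exact (hg.pos ξ hξ _ h).le

set_option synthInstance.maxHeartbeats 200000 in
/-- If the divergence of `X` along all `m`-planes is at most `-c` at the points of a trajectory of
its flow `Φ`, then the squared Jacobian of `Φ δ` on every `m`-plane is at most `exp (-2cδ)`. -/
theorem det_gramOf_flow_le [FiniteDimensional ℝ E] (hg : IsMetricOn g U) (hU : UniqueDiffOn ℝ U) {X : E → E}
    (hX : ContDiffOn ℝ 1 X U) {δ c : ℝ} (hδ : 0 < δ) {s : Set E} (hs : Convex ℝ s)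
    (hsU : UniqueDiffOn ℝ s) (hspan : ∀ ξ ∈ s, ∀ v, ∃ a : ℝ, a ≠ 0 ∧ ξ + a • v ∈ s)
    {Φ : ℝ → E → E} (hΦ : ContDiffOn ℝ 1 (Function.uncurry Φ) (Icc 0 δ ×ˢ s))
    (hmaps : ∀ t ∈ Icc 0 δ, MapsTo (Φ t) s U) (hΦ0 : ∀ ξ ∈ s, Φ 0 ξ = ξ)
    (hflow : ∀ ξ ∈ s, ∀ t ∈ Icc 0 δ, HasDerivWithinAt (fun t => Φ t ξ) (X (Φ t ξ)) (Icc 0 δ) t)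
    {m : ℕ} {ξ : E} (hξ : ξ ∈ s)
    (hdiv : ∀ t ∈ Icc 0 δ, ∀ u : Fin m → E, IsFrame (g (Φ t ξ)) u →
      ∑ i, halfLieDeriv g U X (Φ t ξ) (u i) ≤ -c) {u : Fin m → E} (hu : IsFrame (g ξ) u) :
    (gramOf (g (Φ δ ξ)) fun i => fderivWithin ℝ (Φ δ) s ξ (u i)).det ≤ Real.exp (-2 * c * δ) := by
  have hUp : UniqueDiffOn ℝ (Icc 0 δ ×ˢ s) := (uniqueDiffOn_Icc hδ).prod hsU
  -- the spatial derivative of the flow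
  set D : ℝ → E → E →L[ℝ] E := fun t ξ =>
    (fderivWithin ℝ (Function.uncurry Φ) (Icc 0 δ ×ˢ s) (t, ξ)).comp
      (ContinuousLinearMap.inr ℝ ℝ E) with hD
  have hD' : ∀ t ∈ Icc 0 δ, ∀ ξ ∈ s, HasFDerivWithinAt (Φ t) (D t ξ) s ξ := by
    intro t ht ξ hξ
    have h1 : HasFDerivWithinAt (fun ξ : E => (t, ξ)) (ContinuousLinearMap.inr ℝ ℝ E) s ξ :=
      (hasFDerivAt_prodMk_right t ξ).hasFDerivWithinAt
    have h2 := (hΦ.differentiableOn one_ne_zero (t, ξ) ⟨ht, hξ⟩).hasFDerivWithinAt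
    exact h2.comp ξ h1 fun η hη => ⟨ht, hη⟩
  have hDc : ContinuousOn (Function.uncurry D) (Icc 0 δ ×ˢ s) :=
    (hΦ.continuousOn_fderivWithin hUp le_rfl).clm_comp continuousOn_const
  have hDX : ∀ ξ ∈ U, HasFDerivWithinAt X (fderivWithin ℝ X U ξ) U ξ := fun ξ hξ =>
    (hX.differentiableOn one_ne_zero ξ hξ).hasFDerivWithinAt
  have hode : ∀ v, ∀ t ∈ Icc 0 δ, HasDerivWithinAt (fun t => D t ξ v)
      (fderivWithin ℝ X U (Φ t ξ) (D t ξ v)) (Icc 0 δ) t := by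
    intro v t ht
    obtain ⟨a, ha, hav⟩ := hspan ξ hξ v
    have h := hasDerivWithinAt_fderiv_flow hDX (hX.continuousOn_fderivWithin hU le_rfl) hs hmaps
      hΦ.continuousOn hD' hDc hflow hξ hav ht
    have h2 := h.const_smul a⁻¹
    simp only [map_smul] at h2
    rw [inv_smul_smul₀ ha] at h2
    refine h2.congr (fun τ _ => ?_) ?_ <;> simp [inv_smul_smul₀ ha]
  set w : ℝ → Fin m → E := fun t i => D t ξ (u i) with hw
  set G' : ℝ → Matrix (Fin m) (Fin m) ℝ := fun t =>
    gramOf (fderivWithin ℝ g U (Φ t ξ) (X (Φ t ξ))) (w t) +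
    gramOf ((g (Φ t ξ)).comp (fderivWithin ℝ X U (Φ t ξ))) (w t) +
    (gramOf ((g (Φ t ξ)).comp (fderivWithin ℝ X U (Φ t ξ))) (w t)).transpose with hG'
  have hder : ∀ t ∈ Icc 0 δ, ∀ i j, HasDerivWithinAt
      (fun t => gramOf (g (Φ t ξ)) (w t) i j) (G' t i j) (Icc 0 δ) t := by
    intro t ht i j
    have hΦt : Φ t ξ ∈ U := hmaps t ht hξ
    have h1 : HasDerivWithinAt (fun t => g (Φ t ξ)) (fderivWithin ℝ g U (Φ t ξ) (X (Φ t ξ)))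
        (Icc 0 δ) t :=
      HasFDerivWithinAt.comp_hasDerivWithinAt (l := g) t
        (hg.contDiffOn.differentiableOn one_ne_zero _ hΦt).hasFDerivWithinAt (hflow ξ hξ t ht) fun τ hτ => hmaps τ hτ hξ
    have h2 := (h1.clm_apply (hode (u i) t ht)).clm_apply (hode (u j) t ht)
    refine h2.congr_deriv ?_
    simp only [hG', gramOf, Matrix.add_apply, Matrix.of_apply, Matrix.transpose_apply,
      _root_.add_apply, ContinuousLinearMap.comp_apply, hw]
    rw [hg.symm _ hΦt (D t ξ (u i))]
  have hDδ : fderivWithin ℝ (Φ δ) s ξ = D δ ξ :=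
    (hD' δ ⟨hδ.le, le_rfl⟩ ξ hξ).fderivWithin (hsU ξ hξ)
  have hD0 : D 0 ξ = ContinuousLinearMap.id ℝ E :=
    (hsU ξ hξ).eq (hD' 0 ⟨le_rfl, hδ.le⟩ ξ hξ)
      ((hasFDerivWithinAt_id ξ s).congr (fun η hη => hΦ0 η hη) (hΦ0 ξ hξ))
  rw [hDδ]
  refine det_le_exp_of_trace_deriv_le (G := fun t => gramOf (g (Φ t ξ)) (w t)) (G' := G') hδ.le
    (fun i j t ht => (hder t ht i j).continuousWithinAt) ?_ ?_ ?_ ?_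
  · exact fun t ht i j => (hder t (Ioo_subset_Icc_self ht) i j).hasDerivAt (Icc_mem_nhds ht.1 ht.2)
  · exact fun t ht => hg.posSemidef_gramOf (hmaps t ht hξ) _
  · ext i j
    simp [gramOf, hw, hD0, hΦ0 ξ hξ, hu i j, Matrix.one_apply]
  · intro t ht M hM
    have ht' := Ioo_subset_Icc_self ht
    rw [mul_gramOf_mul_transpose] at hM
    set z : Fin m → E := fun i => ∑ k, M i k • w t k with hz
    have hzf : IsFrame (g (Φ t ξ)) z := fun i j => by
      have := congrFun (congrFun hM i) j
      simpa [gramOf, Matrix.one_apply] using this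
    have htrans : ∀ A : Matrix (Fin m) (Fin m) ℝ,
        M * A.transpose * M.transpose = (M * A * M.transpose).transpose := fun A => by
      simp [Matrix.transpose_mul, Matrix.mul_assoc]
    have hsum : (M * G' t * M.transpose).trace = 2 * ∑ i, halfLieDeriv g U X (Φ t ξ) (z i) := by
      simp only [hG', Matrix.mul_add, Matrix.add_mul, htrans, mul_gramOf_mul_transpose,
        Matrix.trace_add, Matrix.trace_transpose]
      simp only [Matrix.trace, Matrix.diag_apply, gramOf, Matrix.of_apply, halfLieDeriv,
        ContinuousLinearMap.comp_apply, Finset.mul_sum, ← Finset.sum_add_distrib]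
      refine Finset.sum_congr rfl fun i _ => by ring
    rw [hsum]
    linarith [hdiv t ht' z hzf]

end IsMetricOn

end LocalFlow

/-! ### The metric in a chart -/

section Chart

variable {n : ℕ} [NeZero n] {N : Type*} [TopologicalSpace N]
  [ChartedSpace (EuclideanHalfSpace n) N] [IsManifold (𝓡∂ n) ∞ N]

/-- The coordinates of a tangent vector at `x` in the preferred chart at `p`. -/
def toCoord (p x : N) : TangentSpace (𝓡∂ n) x →L[ℝ] EuclideanSpace ℝ (Fin n) :=
  (trivializationAt (EuclideanSpace ℝ (Fin n)) (TangentSpace (𝓡∂ n)) p).continuousLinearMapAt ℝ x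

/-- The tangent vector at `x` with given coordinates in the preferred chart at `p`; it is zero if `x`
is outside of that chart. -/
def ofCoord (p x : N) : EuclideanSpace ℝ (Fin n) →L[ℝ] TangentSpace (𝓡∂ n) x :=
  (trivializationAt (EuclideanSpace ℝ (Fin n)) (TangentSpace (𝓡∂ n)) p).symmL ℝ x

theorem mem_baseSet_iff {p x : N} : x ∈ (trivializationAt (EuclideanSpace ℝ (Fin n))
    (TangentSpace (𝓡∂ n)) p).baseSet ↔ x ∈ (extChartAt (𝓡∂ n) p).source := by
  rw [TangentBundle.trivializationAt_baseSet, extChartAt_source]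

theorem ofCoord_toCoord {p x : N} (hx : x ∈ (extChartAt (𝓡∂ n) p).source)
    (v : TangentSpace (𝓡∂ n) x) : ofCoord p x (toCoord p x v) = v :=
  Trivialization.symmL_continuousLinearMapAt _ (mem_baseSet_iff.2 hx) v

theorem toCoord_ofCoord {p x : N} (hx : x ∈ (extChartAt (𝓡∂ n) p).source)
    (v : EuclideanSpace ℝ (Fin n)) : toCoord p x (ofCoord p x v) = v :=
  Trivialization.continuousLinearMapAt_symmL _ (mem_baseSet_iff.2 hx) v

theorem ofCoord_of_notMem {p x : N} (hx : x ∉ (extChartAt (𝓡∂ n) p).source)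
    (v : EuclideanSpace ℝ (Fin n)) : ofCoord p x v = 0 :=
  Trivialization.symmL_apply_of_notMem _ (fun h => hx (mem_baseSet_iff.1 h)) v

theorem toCoord_eq_mfderiv {p x : N} (hx : x ∈ (extChartAt (𝓡∂ n) p).source) :
    toCoord p x = mfderiv (𝓡∂ n) 𝓘(ℝ, EuclideanSpace ℝ (Fin n)) (extChartAt (𝓡∂ n) p) x :=
  TangentBundle.continuousLinearMapAt_trivializationAt (by rwa [← extChartAt_source (𝓡∂ n)])

theorem chartCoord_eq (p : N) : chartCoord (n := n) p = toCoord p p :=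
  (toCoord_eq_mfderiv (mem_extChartAt_source p)).symm

/-- The tangent vector field with coordinates `v` is smooth, jointly in the point and in `v`. -/
theorem contMDiffOn_ofCoord (p : N) :
    ContMDiffOn ((𝓡∂ n).prod 𝓘(ℝ, EuclideanSpace ℝ (Fin n))) (𝓡∂ n).tangent ∞
      (fun q : N × EuclideanSpace ℝ (Fin n) =>
        (⟨q.1, ofCoord p q.1 q.2⟩ : TangentBundle (𝓡∂ n) N))
      ((extChartAt (𝓡∂ n) p).source ×ˢ univ) := by
  have h := Trivialization.contMDiffOn_symm (IB := 𝓡∂ n) (n := ∞)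
    (trivializationAt (EuclideanSpace ℝ (Fin n)) (TangentSpace (𝓡∂ n)) p)
  refine (h.mono ?_).congr ?_
  · intro q hq
    rw [Trivialization.mem_target]
    exact mem_baseSet_iff.2 hq.1
  · intro q hq
    have hb := mem_baseSet_iff.2 hq.1
    rw [ofCoord, Trivialization.symmL_apply _ hb, Trivialization.mk_symm _ hb]

variable [RiemannianBundle (fun x : N => TangentSpace (𝓡∂ n) x)]

/-- The Riemannian metric in the coordinates of the preferred chart at `p`. -/
def pullMetric (p : N) (ξ : EuclideanSpace ℝ (Fin n)) :
    EuclideanSpace ℝ (Fin n) →L[ℝ] EuclideanSpace ℝ (Fin n) →L[ℝ] ℝ :=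
  (innerSL ℝ (E := TangentSpace (𝓡∂ n) ((extChartAt (𝓡∂ n) p).symm ξ))).bilinearComp
    (ofCoord p ((extChartAt (𝓡∂ n) p).symm ξ)) (ofCoord p ((extChartAt (𝓡∂ n) p).symm ξ))

theorem pullMetric_apply (p : N) (ξ v w : EuclideanSpace ℝ (Fin n)) :
    pullMetric p ξ v w = inner ℝ (ofCoord p ((extChartAt (𝓡∂ n) p).symm ξ) v)
      (ofCoord p ((extChartAt (𝓡∂ n) p).symm ξ) w) := rfl

theorem pullMetric_extChartAt {p x : N} (hx : x ∈ (extChartAt (𝓡∂ n) p).source)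
    (v w : EuclideanSpace ℝ (Fin n)) :
    pullMetric p (extChartAt (𝓡∂ n) p x) v w = inner ℝ (ofCoord p x v) (ofCoord p x w) := by
  rw [pullMetric_apply, (extChartAt (𝓡∂ n) p).left_inv hx]

theorem pullMetric_toCoord {p x : N} (hx : x ∈ (extChartAt (𝓡∂ n) p).source)
    (v w : TangentSpace (𝓡∂ n) x) :
    pullMetric p (extChartAt (𝓡∂ n) p x) (toCoord p x v) (toCoord p x w) = inner ℝ v w := by
  rw [pullMetric_extChartAt hx, ofCoord_toCoord hx, ofCoord_toCoord hx]

theorem chartMetric_eq {p : N} {ξ : EuclideanSpace ℝ (Fin n)}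
    (hξ : ξ ∈ (extChartAt (𝓡∂ n) p).target) (v w : EuclideanSpace ℝ (Fin n)) :
    chartMetric p v w ξ = pullMetric p ξ v w := by
  have hx := (extChartAt (𝓡∂ n) p).map_target hξ
  have h := TangentBundle.symmL_trivializationAt (𝕜 := ℝ) (I := 𝓡∂ n) (x₀ := p)
    (x := (extChartAt (𝓡∂ n) p).symm ξ) (by rwa [← extChartAt_source (𝓡∂ n)])
  have h2 : ∀ v, ofCoord p ((extChartAt (𝓡∂ n) p).symm ξ) v =
      mfderivWithin 𝓘(ℝ, EuclideanSpace ℝ (Fin n)) (𝓡∂ n) (extChartAt (𝓡∂ n) p).symm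
      (range (𝓡∂ n)) ξ v := by
    intro v
    have h3 := congrArg (fun T : EuclideanSpace ℝ (Fin n) →L[ℝ] EuclideanSpace ℝ (Fin n) => T v) h
    refine Eq.trans h3 ?_
    exact congrArg (fun η => (mfderivWithin 𝓘(ℝ, EuclideanSpace ℝ (Fin n)) (𝓡∂ n)
      (extChartAt (𝓡∂ n) p).symm (range (𝓡∂ n)) η : EuclideanSpace ℝ (Fin n) →L[ℝ]
      EuclideanSpace ℝ (Fin n)) v) ((extChartAt (𝓡∂ n) p).right_inv hξ)
  rw [pullMetric_apply, h2, h2]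
  rfl

theorem isMetricOn_pullMetric [IsContMDiffRiemannianBundle (𝓡∂ n) ∞ (EuclideanSpace ℝ (Fin n))
    (fun x : N => TangentSpace (𝓡∂ n) x)] (p : N) :
    IsMetricOn (pullMetric p) (extChartAt (𝓡∂ n) p).target where
  contDiffOn := by
    refine contDiffOn_clm_apply.2 fun v => contDiffOn_clm_apply.2 fun w => ?_
    have hsec : ∀ v : EuclideanSpace ℝ (Fin n), ContMDiffOn 𝓘(ℝ, EuclideanSpace ℝ (Fin n))
        (𝓡∂ n).tangent ∞ (fun ξ => (⟨(extChartAt (𝓡∂ n) p).symm ξ,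
          ofCoord p ((extChartAt (𝓡∂ n) p).symm ξ) v⟩ : TangentBundle (𝓡∂ n) N))
        (extChartAt (𝓡∂ n) p).target := fun v =>
      (contMDiffOn_ofCoord p).comp (f := fun ξ => ((extChartAt (𝓡∂ n) p).symm ξ, v))
        ((contMDiffOn_extChartAt_symm p).prodMk contMDiffOn_const)
        fun ξ hξ => ⟨(extChartAt (𝓡∂ n) p).map_target hξ, mem_univ _⟩
    have h := ContMDiffOn.inner_bundle (hsec v) (hsec w)
    exact (contMDiffOn_iff_contDiffOn.1 h).of_le (by simp)
  symm ξ _ v w := by rw [pullMetric_apply, pullMetric_apply, real_inner_comm]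
  pos ξ hξ v hv := by
    rw [pullMetric_apply]
    refine real_inner_self_pos.2 fun h => hv ?_
    rw [← toCoord_ofCoord ((extChartAt (𝓡∂ n) p).map_target hξ) v, h, map_zero]

end Chart

/-! ### Half-balls and the convexity hypothesis -/

section HalfBall

variable {n : ℕ} [NeZero n]

/-- The part of the open ball in the closed half-space `{0 ≤ x 0}`. -/
def halfBall (c : EuclideanSpace ℝ (Fin n)) (R : ℝ) : Set (EuclideanSpace ℝ (Fin n)) :=
  {ξ | 0 ≤ ξ 0} ∩ Metric.ball c R

theorem halfBall_eq (c : EuclideanSpace ℝ (Fin n)) (R : ℝ) :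
    halfBall c R = range (𝓡∂ n) ∩ Metric.ball c R := by
  rw [halfBall, range_modelWithCornersEuclideanHalfSpace]

theorem uniqueDiffOn_halfBall (c : EuclideanSpace ℝ (Fin n)) (R : ℝ) :
    UniqueDiffOn ℝ (halfBall c R) := by
  rw [halfBall_eq]
  exact (𝓡∂ n).uniqueDiffOn.inter Metric.isOpen_ball

theorem convex_halfBall (c : EuclideanSpace ℝ (Fin n)) (R : ℝ) : Convex ℝ (halfBall c R) := by
  rw [halfBall_eq]
  exact (𝓡∂ n).convex_range.inter (convex_ball c R)

theorem halfBall_mono (c : EuclideanSpace ℝ (Fin n)) {r R : ℝ} (h : r ≤ R) :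
    halfBall c r ⊆ halfBall c R := inter_subset_inter_right _ (Metric.ball_subset_ball h)

/-- From a point of a half-ball one can move into the half-ball along `v` or along `-v`. -/
theorem exists_add_smul_mem_halfBall {c : EuclideanSpace ℝ (Fin n)} {R : ℝ}
    {ξ : EuclideanSpace ℝ (Fin n)} (hξ : ξ ∈ halfBall c R) (v : EuclideanSpace ℝ (Fin n)) :
    ∃ a : ℝ, a ≠ 0 ∧ ξ + a • v ∈ halfBall c R := by
  obtain ⟨h0, hd⟩ := hξ
  have hc : Continuous fun a : ℝ => ξ + a • v := by fun_prop
  have hnhds : ∀ᶠ a : ℝ in 𝓝 0, ξ + a • v ∈ Metric.ball c R :=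
    hc.continuousAt.eventually_mem (by simpa using Metric.isOpen_ball.mem_nhds hd)
  obtain ⟨ε, hε, hb⟩ := Metric.eventually_nhds_iff.1 hnhds
  rcases le_total 0 (v 0) with hv | hv
  · refine ⟨ε / 2, by positivity, ?_, hb ?_⟩
    · have h0' : 0 ≤ ξ 0 := h0
      show 0 ≤ (ξ + (ε / 2) • v) 0
      simp only [PiLp.add_apply, PiLp.smul_apply, smul_eq_mul]
      positivity
    · rw [Real.dist_eq, sub_zero, abs_of_pos (by positivity)]; linarith
  · refine ⟨-(ε / 2), by simp [hε.ne'], ?_, hb ?_⟩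
    · have h0' : 0 ≤ ξ 0 := h0
      show 0 ≤ (ξ + (-(ε / 2)) • v) 0
      simp only [PiLp.add_apply, PiLp.smul_apply, smul_eq_mul]
      nlinarith
    · rw [Real.dist_eq, sub_zero, abs_neg, abs_of_pos (by positivity)]; linarith

end HalfBall

section Convexity

variable {n : ℕ} [NeZero n] {N : Type*} [TopologicalSpace N]
  [ChartedSpace (EuclideanHalfSpace n) N]

theorem exists_halfBall_subset_target (p : N) :
    ∃ R > 0, halfBall (extChartAt (𝓡∂ n) p p) R ⊆ (extChartAt (𝓡∂ n) p).target := by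
  obtain ⟨R, hR, h⟩ := Metric.mem_nhdsWithin_iff.1 (extChartAt_target_mem_nhdsWithin (I := 𝓡∂ n) p)
  exact ⟨R, hR, fun ξ hξ => h (by rw [halfBall_eq] at hξ; exact ⟨hξ.2, hξ.1⟩)⟩

variable [IsManifold (𝓡∂ n) ∞ N] [RiemannianBundle (fun x : N => TangentSpace (𝓡∂ n) x)]
  [IsContMDiffRiemannianBundle (𝓡∂ n) ∞ (EuclideanSpace ℝ (Fin n))
    (fun x : N => TangentSpace (𝓡∂ n) x)]

set_option synthInstance.maxHeartbeats 200000 in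
theorem christoffel_eq_christoffelOn {p : N} {R : ℝ} (hR : 0 < R)
    (hsub : halfBall (extChartAt (𝓡∂ n) p p) R ⊆ (extChartAt (𝓡∂ n) p).target)
    (u v w : EuclideanSpace ℝ (Fin n)) :
    christoffel p u v w = christoffelOn (pullMetric p) (halfBall (extChartAt (𝓡∂ n) p p) R)
      (extChartAt (𝓡∂ n) p p) u v w := by
  have hξ : extChartAt (𝓡∂ n) p p ∈ halfBall (extChartAt (𝓡∂ n) p p) R := by
    rw [halfBall_eq]
    exact ⟨extChartAt_target_subset_range p (mem_extChartAt_target p), Metric.mem_ball_self hR⟩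
  have key : ∀ u v w, chartMetricDeriv p u v w = fderivWithin ℝ (pullMetric p)
      (halfBall (extChartAt (𝓡∂ n) p p) R) (extChartAt (𝓡∂ n) p p) u v w := by
    intro u v w
    have hd := (((isMetricOn_pullMetric p).mono hsub).contDiffOn.differentiableOn one_ne_zero _
      hξ).hasFDerivWithinAt
    have h1 := (hd.clm_apply (hasFDerivWithinAt_const v _ _)).clm_apply
      (hasFDerivWithinAt_const w _ _)
    have h2 := h1.congr (fun η hη => chartMetric_eq (hsub hη) v w) (chartMetric_eq (hsub hξ) v w)
    have hset : halfBall (extChartAt (𝓡∂ n) p p) R =ᶠ[𝓝 (extChartAt (𝓡∂ n) p p)]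
        range (𝓡∂ n) := by
      rw [halfBall_eq]
      refine Filter.eventuallyEq_set.2 ?_
      filter_upwards [Metric.ball_mem_nhds _ hR] with η hη
      exact ⟨fun h => h.1, fun h => ⟨h, hη⟩⟩
    rw [chartMetricDeriv, ← fderivWithin_congr_set hset,
      h2.fderivWithin (uniqueDiffOn_halfBall _ _ _ hξ)]
    simp
  rw [christoffel, christoffelOn, key, key, key]

/-- At the base point of the chart, the `g`-gradient of the `0`-th coordinate is a positive multiple
of the inward unit normal. -/
theorem metricGrad_proj_eq {p : N} {ν : TangentSpace (𝓡∂ n) p} (hν : IsInwardUnitNormal p ν) :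
    metricGrad (pullMetric p) (fun _ => EuclideanSpace.proj (0 : Fin n)) (extChartAt (𝓡∂ n) p p) =
      toCoord p p ν 0 • toCoord p p ν := by
  have hm := isMetricOn_pullMetric (n := n) p
  have hξ := mem_extChartAt_target (I := 𝓡∂ n) p
  have hx := mem_extChartAt_source (I := 𝓡∂ n) p
  obtain ⟨e, he⟩ := hm.exists_equiv hξ
  have hpos : 0 < toCoord p p ν 0 := by rw [← chartCoord_eq]; exact hν.inward
  have hinj : Function.Injective (pullMetric p (extChartAt (𝓡∂ n) p p)) := by
    rw [← he]; exact e.injective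
  apply hinj
  rw [hm.apply_metricGrad hξ]
  ext v
  set a := v 0 / toCoord p p ν 0 with ha
  -- split `v` into a multiple of the normal and a vector tangent to the boundary
  set t := ofCoord p p v - a • ν with ht
  have ht0 : inner ℝ ν t = 0 := by
    refine hν.orthogonal t ?_
    rw [chartCoord_eq, ht, map_sub, map_smul, toCoord_ofCoord hx]
    simp only [PiLp.sub_apply, PiLp.smul_apply, smul_eq_mul, ha]
    field_simp
    ring
  have hv : v = toCoord p p (t + a • ν) := by
    rw [ht, sub_add_cancel, toCoord_ofCoord hx]
  have hg : pullMetric p (extChartAt (𝓡∂ n) p p) (toCoord p p ν) v = a := by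
    conv_lhs => rw [hv]
    rw [pullMetric_toCoord hx, inner_add_right, ht0, inner_smul_right, real_inner_self_eq_norm_sq,
      hν.norm_eq_one]
    ring
  rw [map_smul, _root_.smul_apply, hg, smul_eq_mul, ha]
  show v 0 = _
  field_simp

set_option synthInstance.maxHeartbeats 200000 in
set_option maxHeartbeats 400000 in
/-- Strong `m`-convexity at `p`, in the coordinates of the chart at `p`: the trace of the second
fundamental form over every `m`-plane tangent to the boundary is positive. -/
theorem sum_christoffelOn_pos {p : N} {m : ℕ} (hconv : StronglyConvexAt (n := n) m p) {R : ℝ}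
    (hR : 0 < R) (hsub : halfBall (extChartAt (𝓡∂ n) p p) R ⊆ (extChartAt (𝓡∂ n) p).target)
    {u : Fin m → EuclideanSpace ℝ (Fin n)} (hu : IsFrame (pullMetric p (extChartAt (𝓡∂ n) p p)) u)
    (hu0 : ∀ i, u i 0 = 0) :
    0 < ∑ i, christoffelOn (pullMetric p) (halfBall (extChartAt (𝓡∂ n) p p) R)
      (extChartAt (𝓡∂ n) p p) (u i) (u i)
      (metricGrad (pullMetric p) (fun _ => EuclideanSpace.proj (0 : Fin n))
        (extChartAt (𝓡∂ n) p p)) := by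
  obtain ⟨hm, κ, ⟨hκ, ν, hν, e, he, he0, hdiag⟩, hpos⟩ := hconv
  have hx := mem_extChartAt_source (I := 𝓡∂ n) p
  have hν0 : 0 < toCoord p p ν 0 := by rw [← chartCoord_eq]; exact hν.inward
  -- the second fundamental form as a bilinear form
  let Q : TangentSpace (𝓡∂ n) p →ₗ[ℝ] TangentSpace (𝓡∂ n) p →ₗ[ℝ] ℝ :=
    LinearMap.mk₂ ℝ (fun a b => secondFundamentalForm p ν a b)
      (fun a b c => by
        simp only [secondFundamentalForm, christoffel_eq_christoffelOn hR hsub, christoffelOn,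
          map_add, _root_.add_apply]; ring)
      (fun s a b => by
        simp only [secondFundamentalForm, christoffel_eq_christoffelOn hR hsub, christoffelOn,
          map_smul, _root_.smul_apply, smul_eq_mul]; ring)
      (fun a b c => by
        simp only [secondFundamentalForm, christoffel_eq_christoffelOn hR hsub, christoffelOn,
          map_add, _root_.add_apply]; ring)
      (fun s a b => by
        simp only [secondFundamentalForm, christoffel_eq_christoffelOn hR hsub, christoffelOn,
          map_smul, _root_.smul_apply, smul_eq_mul]; ring)
  set z : Fin m → TangentSpace (𝓡∂ n) p := fun i => ofCoord p p (u i) with hz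
  have hzon : Orthonormal ℝ z := by
    rw [orthonormal_iff_ite]
    intro i j
    rw [← hu i j, pullMetric_extChartAt hx]
  -- the tangent space of the boundary has dimension `n - 1`, so the frame `e` spans it
  have hspan : ∀ i, z i ∈ Submodule.span ℝ (range e) := by
    set L : TangentSpace (𝓡∂ n) p →ₗ[ℝ] ℝ :=
      ((EuclideanSpace.proj (0 : Fin n) : EuclideanSpace ℝ (Fin n) →L[ℝ] ℝ).comp
        (toCoord p p)).toLinearMap with hL
    have hLapp : ∀ v, L v = toCoord p p v 0 := fun v => rfl
    have hLne : L ≠ 0 := fun h => by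
      have := congrArg (fun T : TangentSpace (𝓡∂ n) p →ₗ[ℝ] ℝ => T ν) h
      simp only [hLapp, LinearMap.zero_apply] at this
      exact hν0.ne' this
    have hle : Submodule.span ℝ (range e) ≤ LinearMap.ker L := by
      rw [Submodule.span_le]
      rintro _ ⟨i, rfl⟩
      have := he0 i
      rw [chartCoord_eq] at this
      exact LinearMap.mem_ker.2 this
    have hfin : Module.finrank ℝ (LinearMap.ker L) + 1 = n := by
      rw [Module.Dual.finrank_ker_add_one_of_ne_zero hLne]
      exact finrank_euclideanSpace_fin (𝕜 := ℝ) (n := n)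
    have hfe : Module.finrank ℝ (Submodule.span ℝ (range e)) = n - 1 := by
      rw [finrank_span_eq_card he.linearIndependent, Fintype.card_fin]
    have heq : Submodule.span ℝ (range e) = LinearMap.ker L :=
      Submodule.eq_of_le_of_finrank_eq hle (by omega)
    intro i
    rw [heq, LinearMap.mem_ker, hLapp, hz, toCoord_ofCoord hx]
    exact hu0 i
  have hKF := sum_castLE_le_sum_of_orthonormal hm Q hκ he hdiag hzon hspan
  have hsum : ∑ i, christoffelOn (pullMetric p) (halfBall (extChartAt (𝓡∂ n) p p) R)
      (extChartAt (𝓡∂ n) p p) (u i) (u i) (metricGrad (pullMetric p)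
        (fun _ => EuclideanSpace.proj (0 : Fin n)) (extChartAt (𝓡∂ n) p p)) =
      toCoord p p ν 0 * ∑ i, Q (z i) (z i) := by
    rw [metricGrad_proj_eq hν, Finset.mul_sum]
    refine Finset.sum_congr rfl fun i _ => ?_
    show _ = toCoord p p ν 0 * secondFundamentalForm p ν (z i) (z i)
    rw [secondFundamentalForm, christoffel_eq_christoffelOn hR hsub, chartCoord_eq, hz,
      toCoord_ofCoord hx]
    simp only [christoffelOn, map_smul, _root_.smul_apply, smul_eq_mul]
    ring
  rw [hsum]
  exact mul_pos hν0 (hpos.trans_le hKF)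

end Convexity

/-! ### Vector fields supported in a chart -/

section Field

variable {n : ℕ} [NeZero n] {N : Type*} [TopologicalSpace N]
  [ChartedSpace (EuclideanHalfSpace n) N]

theorem extChartAt_zero_nonneg {p : N} {ξ : EuclideanSpace ℝ (Fin n)}
    (hξ : ξ ∈ (extChartAt (𝓡∂ n) p).target) : 0 ≤ ξ 0 := by
  have := extChartAt_target_subset_range p hξ
  rwa [range_modelWithCornersEuclideanHalfSpace] at this

/-- In every chart, boundary points lie on the boundary of the half-space. -/
theorem extChartAt_zero_eq_zero [IsManifold (𝓡∂ n) ∞ N] {p x : N} (hx : x ∈ (extChartAt (𝓡∂ n) p).source)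
    (hb : x ∈ (𝓡∂ n).boundary N) : extChartAt (𝓡∂ n) p x 0 = 0 := by
  by_contra hne
  have hpos : 0 < extChartAt (𝓡∂ n) p x 0 :=
    lt_of_le_of_ne (extChartAt_zero_nonneg ((extChartAt (𝓡∂ n) p).map_source hx)) (Ne.symm hne)
  rw [extChartAt_source] at hx
  have hint : extChartAt (𝓡∂ n) p x ∈ interior (range (𝓡∂ n)) := by
    rw [interior_range_modelWithCornersEuclideanHalfSpace]; exact hpos
  have h := (ModelWithCorners.isInteriorPoint_iff_of_mem_atlas (I := 𝓡∂ n) (n := ∞) (by simp)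
    (chart_mem_atlas (EuclideanHalfSpace n) p) hx).2
    ((chartAt (EuclideanHalfSpace n) p).mem_interior_extend_target
      ((chartAt (EuclideanHalfSpace n) p).map_source hx) (by simpa [extChartAt] using hint))
  exact ((𝓡∂ n).isInteriorPoint_iff_not_isBoundaryPoint x).1 h hb

/-- At a boundary point, the normal coordinates in two charts agree up to a positive factor. -/
theorem exists_toCoord_zero_eq_mul [IsManifold (𝓡∂ n) ∞ N] {p x : N} (hx : x ∈ (extChartAt (𝓡∂ n) p).source)
    (hb : x ∈ (𝓡∂ n).boundary N) :
    ∃ c > 0, ∀ v : TangentSpace (𝓡∂ n) x, toCoord p x v 0 = c * chartCoord x v 0 := by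
  have hself : ∀ v : TangentSpace (𝓡∂ n) x, chartCoord x v = v := fun v => by
    rw [chartCoord, mfderiv_extChartAt_self]; rfl
  set ζ := extChartAt (𝓡∂ n) x x with hζ
  set L : EuclideanSpace ℝ (Fin n) →L[ℝ] ℝ := (EuclideanSpace.proj (0 : Fin n)).comp
    (toCoord p x : EuclideanSpace ℝ (Fin n) →L[ℝ] EuclideanSpace ℝ (Fin n)) with hL
  have hζr : ζ ∈ range (𝓡∂ n) := extChartAt_target_subset_range x (mem_extChartAt_target x)
  set h : EuclideanSpace ℝ (Fin n) → ℝ :=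
    fun η => extChartAt (𝓡∂ n) p ((extChartAt (𝓡∂ n) x).symm η) 0 with hh
  have hder : HasFDerivWithinAt h L (range (𝓡∂ n)) ζ := by
    have h1 : HasMFDerivAt (𝓡∂ n) 𝓘(ℝ, EuclideanSpace ℝ (Fin n)) (extChartAt (𝓡∂ n) p) x
        (toCoord p x) := by
      rw [toCoord_eq_mfderiv hx]
      exact (mdifferentiableAt_extChartAt (by rwa [← extChartAt_source (𝓡∂ n)])).hasMFDerivAt
    exact (EuclideanSpace.proj (0 : Fin n) : EuclideanSpace ℝ (Fin n) →L[ℝ] ℝ).hasFDerivAt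
      |>.comp_hasFDerivWithinAt ζ h1.2
  have hmin : IsLocalMinOn h (range (𝓡∂ n)) ζ := by
    have h0 : h ζ = 0 := by
      simp only [hh, hζ, extChartAt_to_inv]
      exact extChartAt_zero_eq_zero hx hb
    have hev : ∀ᶠ η in 𝓝[range (𝓡∂ n)] ζ,
        (extChartAt (𝓡∂ n) x).symm η ∈ (extChartAt (𝓡∂ n) p).source := by
      have hc := (continuousAt_extChartAt_symm (I := 𝓡∂ n) x)
      refine (hc.eventually_mem ?_).filter_mono nhdsWithin_le_nhds
      rw [extChartAt_to_inv]
      exact (isOpen_extChartAt_source p).mem_nhds hx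
    filter_upwards [hev] with η hη
    rw [h0]
    exact extChartAt_zero_nonneg ((extChartAt (𝓡∂ n) p).map_source hη)
  have hnonneg : ∀ v : EuclideanSpace ℝ (Fin n), 0 ≤ v 0 → 0 ≤ L v := by
    intro v hv
    refine hmin.hasFDerivWithinAt_nonneg hder (mem_posTangentConeAt_of_segment_subset ?_)
    rw [range_modelWithCornersEuclideanHalfSpace] at hζr ⊢
    refine (convex_halfSpace_ge ?_ 0).segment_subset hζr ?_
    · exact (EuclideanSpace.proj (0 : Fin n) :
        EuclideanSpace ℝ (Fin n) →L[ℝ] ℝ).isBoundedLinearMap.toIsLinearMap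
    · have : 0 ≤ ζ 0 := hζr
      show 0 ≤ (ζ + v) 0
      simp only [PiLp.add_apply]
      positivity
  have hzero : ∀ v : EuclideanSpace ℝ (Fin n), v 0 = 0 → L v = 0 := by
    intro v hv
    have h1 := hnonneg v hv.ge
    have h2 := hnonneg (-v) (by simp [hv])
    rw [map_neg] at h2
    linarith
  set e₀ : EuclideanSpace ℝ (Fin n) := EuclideanSpace.single 0 1 with he₀
  have hLv : ∀ v, L v = L e₀ * v 0 := by
    intro v
    have := hzero (v - v 0 • e₀) (by simp [he₀])
    rw [map_sub, map_smul, smul_eq_mul] at this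
    linarith
  have hLv' : ∀ v : TangentSpace (𝓡∂ n) x, toCoord p x v 0 = L e₀ * chartCoord x v 0 := by
    intro v
    rw [hself]
    exact hLv v
  refine ⟨L e₀, lt_of_le_of_ne (hnonneg e₀ (by simp [he₀])) fun h0 => ?_, hLv'⟩
  have h1 := hLv' (ofCoord p x e₀)
  rw [toCoord_ofCoord hx, ← h0] at h1
  simp [he₀] at h1

/-- The part of the chart at `p` that corresponds to a closed ball. -/
def chartClosedBall (p : N) (r : ℝ) : Set N :=
  (extChartAt (𝓡∂ n) p).symm '' ({ξ | 0 ≤ ξ 0} ∩ Metric.closedBall (extChartAt (𝓡∂ n) p p) r)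

/-- The part of the chart at `p` that corresponds to an open ball. -/
def chartBall (p : N) (r : ℝ) : Set N :=
  (extChartAt (𝓡∂ n) p).source ∩
    extChartAt (𝓡∂ n) p ⁻¹' Metric.ball (extChartAt (𝓡∂ n) p p) r

theorem isOpen_chartBall (p : N) (r : ℝ) : IsOpen (chartBall (n := n) p r) :=
  (continuousOn_extChartAt p).isOpen_inter_preimage (isOpen_extChartAt_source p) Metric.isOpen_ball

theorem mem_chartBall_self (p : N) {r : ℝ} (hr : 0 < r) : p ∈ chartBall (n := n) p r :=
  ⟨mem_extChartAt_source p, Metric.mem_ball_self hr⟩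

theorem extChartAt_mem_halfBall {p x : N} {r : ℝ} (hx : x ∈ chartBall (n := n) p r) :
    extChartAt (𝓡∂ n) p x ∈ halfBall (extChartAt (𝓡∂ n) p p) r :=
  ⟨extChartAt_zero_nonneg ((extChartAt (𝓡∂ n) p).map_source hx.1), hx.2⟩

theorem chartBall_subset_chartClosedBall (p : N) (r : ℝ) :
    chartBall (n := n) p r ⊆ chartClosedBall (n := n) p r := fun x hx =>
  ⟨extChartAt (𝓡∂ n) p x, ⟨(extChartAt_mem_halfBall hx).1,
    Metric.ball_subset_closedBall hx.2⟩, (extChartAt (𝓡∂ n) p).left_inv hx.1⟩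

theorem inter_closedBall_subset_target {p : N} {R r : ℝ}
    (hsub : halfBall (extChartAt (𝓡∂ n) p p) R ⊆ (extChartAt (𝓡∂ n) p).target) (hr : r < R) :
    {ξ | 0 ≤ ξ 0} ∩ Metric.closedBall (extChartAt (𝓡∂ n) p p) r ⊆ (extChartAt (𝓡∂ n) p).target :=
  fun _ hξ => hsub ⟨hξ.1, Metric.closedBall_subset_ball hr hξ.2⟩

theorem isCompact_chartClosedBall {p : N} {R r : ℝ}
    (hsub : halfBall (extChartAt (𝓡∂ n) p p) R ⊆ (extChartAt (𝓡∂ n) p).target) (hr : r < R) :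
    IsCompact (chartClosedBall (n := n) p r) := by
  refine IsCompact.image_of_continuousOn ?_
    ((continuousOn_extChartAt_symm p).mono (inter_closedBall_subset_target hsub hr))
  refine (isCompact_closedBall _ _).inter_left (isClosed_le continuous_const ?_)
  exact (EuclideanSpace.proj (0 : Fin n) : EuclideanSpace ℝ (Fin n) →L[ℝ] ℝ).continuous

theorem chartClosedBall_subset_chartBall {p : N} {R r : ℝ}
    (hsub : halfBall (extChartAt (𝓡∂ n) p p) R ⊆ (extChartAt (𝓡∂ n) p).target) (hr : r < R)
    {r' : ℝ} (hr' : r < r') :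
    chartClosedBall (n := n) p r ⊆ chartBall (n := n) p r' := by
  rintro _ ⟨ξ, hξ, rfl⟩
  have ht := inter_closedBall_subset_target hsub hr hξ
  refine ⟨(extChartAt (𝓡∂ n) p).map_target ht, ?_⟩
  rw [mem_preimage, (extChartAt (𝓡∂ n) p).right_inv ht]
  exact Metric.closedBall_subset_ball hr' hξ.2

variable [IsManifold (𝓡∂ n) ∞ N]

/-- The vector field on `N` with coordinates `X` in the preferred chart at `p`, extended by zero. -/
def chartField (p : N) (X : EuclideanSpace ℝ (Fin n) → EuclideanSpace ℝ (Fin n)) (x : N) :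
    TangentSpace (𝓡∂ n) x :=
  ofCoord p x (X (extChartAt (𝓡∂ n) p x))

theorem support_chartField_subset {p : N} {r : ℝ}
    {X : EuclideanSpace ℝ (Fin n) → EuclideanSpace ℝ (Fin n)}
    (hX : ∀ ξ, 0 ≤ ξ 0 → X ξ ≠ 0 → dist ξ (extChartAt (𝓡∂ n) p p) ≤ r) :
    {x : N | chartField p X x ≠ 0} ⊆ chartClosedBall (n := n) p r := by
  intro x hx
  have hsrc : x ∈ (extChartAt (𝓡∂ n) p).source := by
    by_contra h
    exact hx (ofCoord_of_notMem h _)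
  have h0 := extChartAt_zero_nonneg ((extChartAt (𝓡∂ n) p).map_source hsrc)
  refine ⟨extChartAt (𝓡∂ n) p x, ⟨h0, hX _ h0 fun h => hx ?_⟩,
    (extChartAt (𝓡∂ n) p).left_inv hsrc⟩
  rw [chartField, h, map_zero]

/-- A coordinate vector field of class `C^1` with support in a small ball that does not point out of
the half-space defines an admissible vector field. -/
theorem isAdmissible_chartField [T2Space N] [RiemannianBundle (fun x : N => TangentSpace (𝓡∂ n) x)]
    {p : N} {R r : ℝ}
    (hsub : halfBall (extChartAt (𝓡∂ n) p p) R ⊆ (extChartAt (𝓡∂ n) p).target) (hr : r < R)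
    {X : EuclideanSpace ℝ (Fin n) → EuclideanSpace ℝ (Fin n)}
    (hXc : ContDiffOn ℝ 1 X (halfBall (extChartAt (𝓡∂ n) p p) R))
    (hX : ∀ ξ, 0 ≤ ξ 0 → X ξ ≠ 0 → dist ξ (extChartAt (𝓡∂ n) p p) ≤ r)
    (hX0 : ∀ ξ ∈ halfBall (extChartAt (𝓡∂ n) p p) R, 0 ≤ X ξ 0) :
    IsAdmissible (n := n) (chartField p X) := by
  have hK := isCompact_chartClosedBall hsub hr
  have hsupp := support_chartField_subset (p := p) hX
  have hKsub := chartClosedBall_subset_chartBall hsub hr hr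
  refine ⟨fun x => ?_, hK.of_isClosed_subset isClosed_closure
    (closure_minimal hsupp hK.isClosed), ?_⟩
  · by_cases hx : x ∈ chartClosedBall (n := n) p r
    · have hO : chartBall (n := n) p R ∈ 𝓝 x := (isOpen_chartBall p R).mem_nhds (hKsub hx)
      have h1 : ContMDiffOn (𝓡∂ n) 𝓘(ℝ, EuclideanSpace ℝ (Fin n)) 1
          (fun x => X (extChartAt (𝓡∂ n) p x)) (chartBall (n := n) p R) := by
        refine ContMDiffOn.comp (t := halfBall (extChartAt (𝓡∂ n) p p) R)
          (contMDiffOn_iff_contDiffOn.2 hXc) (contMDiffOn_extChartAt.mono fun x hx => ?_)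
          fun x hx => extChartAt_mem_halfBall hx
        rw [← extChartAt_source (𝓡∂ n)]
        exact hx.1
      have h2 : ContMDiffOn (𝓡∂ n) (𝓡∂ n).tangent 1
          (fun x => (⟨x, chartField p X x⟩ : TangentBundle (𝓡∂ n) N))
          (chartBall (n := n) p R) :=
        ((contMDiffOn_ofCoord p).of_le (by simp)).comp (f := fun x : N =>
          (x, X (extChartAt (𝓡∂ n) p x))) (contMDiffOn_id.prodMk h1)
          fun x hx => ⟨hx.1, mem_univ _⟩
      exact h2.contMDiffAt hO
    · have hz : ContMDiff (𝓡∂ n) (𝓡∂ n).tangent 1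
          (zeroSection (EuclideanSpace ℝ (Fin n)) (TangentSpace (𝓡∂ n) (M := N))) :=
        contMDiff_zeroSection ℝ _
      refine (hz x).congr_of_eventuallyEq ?_
      filter_upwards [hK.isClosed.isOpen_compl.mem_nhds hx] with y hy
      have : chartField p X y = 0 := by
        by_contra h
        exact hy (hsupp h)
      rw [this]
      rfl
  · intro x hb ν hν
    by_cases hz : chartField p X x = 0
    · rw [hz, inner_zero_left]
    · have hx := hKsub (hsupp hz)
      obtain ⟨c, hc, hcv⟩ := exists_toCoord_zero_eq_mul hx.1 hb
      set a := X (extChartAt (𝓡∂ n) p x) 0 / toCoord p x ν 0 with ha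
      have hν0 : 0 < toCoord p x ν 0 := by rw [hcv]; exact mul_pos hc hν.inward
      have ha0 : 0 ≤ a := div_nonneg (hX0 _ (extChartAt_mem_halfBall hx)) hν0.le
      -- the field is `a • ν` up to a vector tangent to the boundary
      have htan : inner ℝ ν (chartField p X x - a • ν) = 0 := by
        refine hν.orthogonal _ ?_
        have h1 := hcv (chartField p X x - a • ν)
        rw [map_sub, map_smul, chartField, toCoord_ofCoord hx.1] at h1
        simp only [PiLp.sub_apply, PiLp.smul_apply, smul_eq_mul, ha] at h1
        rw [div_mul_cancel₀ _ hν0.ne', sub_self] at h1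
        exact (mul_eq_zero.1 h1.symm).resolve_left hc.ne'
      rw [inner_sub_right, inner_smul_right, real_inner_self_eq_norm_sq, hν.norm_eq_one] at htan
      rw [real_inner_comm]
      linarith

end Field

/-! ### Mass over compact sets and Jacobians -/

section Finite

variable {n : ℕ} [NeZero n] {N : Type*} [TopologicalSpace N]
  [ChartedSpace (EuclideanHalfSpace n) N]
  [RiemannianBundle (fun x : N => TangentSpace (𝓡∂ n) x)] {m : ℕ}

/-- The orthonormal basis of the plane `S`, indexed by `Fin m`. -/
def TangentPlane.basis (S : TangentPlane n N m) : OrthonormalBasis (Fin m) ℝ S.plane :=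
  (stdOrthonormalBasis ℝ S.plane).reindex (finCongr S.finrank_eq)

theorem TangentPlane.span_basis (S : TangentPlane n N m) :
    Submodule.span ℝ (range fun i => (S.basis i : TangentSpace (𝓡∂ n) S.base)) = S.plane := by
  have h : range (fun i => (S.basis i : TangentSpace (𝓡∂ n) S.base)) =
      S.plane.subtype '' range S.basis := by
    rw [← range_comp]; rfl
  rw [h, Submodule.span_image]
  have := S.basis.toBasis.span_eq
  rw [OrthonormalBasis.coe_toBasis] at this
  rw [this, Submodule.map_subtype_top]

theorem TangentPlane.orthonormal_basis (S : TangentPlane n N m) :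
    Orthonormal ℝ fun i => (S.basis i : TangentSpace (𝓡∂ n) S.base) :=
  S.basis.orthonormal.comp_linearIsometry S.plane.subtypeₗᵢ

variable [IsManifold (𝓡∂ n) ∞ N]

/-- The coordinates of an orthonormal basis of `S` form an orthonormal frame. -/
theorem TangentPlane.isFrame_basis {p : N} (S : TangentPlane n N m)
    (hS : S.base ∈ (extChartAt (𝓡∂ n) p).source) :
    IsFrame (pullMetric p (extChartAt (𝓡∂ n) p S.base)) fun i => toCoord p S.base (S.basis i) := by
  intro i j
  rw [pullMetric_toCoord hS]
  exact orthonormal_iff_ite.1 S.orthonormal_basis i j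

/-- A varifold has finite mass over a compact part of a chart. The planes over that part are the
spans of a compact family of orthonormal frames. -/
theorem Varifold.measure_chartClosedBall_lt_top
    [IsContMDiffRiemannianBundle (𝓡∂ n) ∞ (EuclideanSpace ℝ (Fin n))
      (fun x : N => TangentSpace (𝓡∂ n) x)] (V : Varifold n N m) {p : N} {R r : ℝ}
    (hsub : halfBall (extChartAt (𝓡∂ n) p p) R ⊆ (extChartAt (𝓡∂ n) p).target) (hr : r < R) :
    V.measure {S | S.base ∈ chartClosedBall (n := n) p r} < ⊤ := by
  set B := {ξ : EuclideanSpace ℝ (Fin n) | 0 ≤ ξ 0} ∩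
    Metric.closedBall (extChartAt (𝓡∂ n) p p) r with hB
  have hBt : B ⊆ (extChartAt (𝓡∂ n) p).target := inter_closedBall_subset_target hsub hr
  have hBc : IsCompact B := by
    refine (isCompact_closedBall _ _).inter_left (isClosed_le continuous_const ?_)
    exact (EuclideanSpace.proj (0 : Fin n) : EuclideanSpace ℝ (Fin n) →L[ℝ] ℝ).continuous
  set C := {q : EuclideanSpace ℝ (Fin n) × (Fin m → EuclideanSpace ℝ (Fin n)) |
    q.1 ∈ B ∧ IsFrame (pullMetric p q.1) q.2} with hC
  have hCc : IsCompact C := (isMetricOn_pullMetric p).isCompact_frames hBc hBt (Fin m)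
  have : CompactSpace C := isCompact_iff_compactSpace.1 hCc
  let F : C → TangentFrame n N m := fun q =>
    { base := (extChartAt (𝓡∂ n) p).symm q.1.1
      vec := fun i => ofCoord p ((extChartAt (𝓡∂ n) p).symm q.1.1) (q.1.2 i)
      linearIndependent := by
        refine Orthonormal.linearIndependent (𝕜 := ℝ) ?_
        rw [orthonormal_iff_ite]
        exact fun i j => q.2.2 i j }
  have hFc : Continuous F := by
    refine continuous_induced_rng.2 ?_
    have hbase : Continuous fun q : C => (extChartAt (𝓡∂ n) p).symm q.1.1 :=
      ((continuousOn_extChartAt_symm p).mono hBt).comp_continuous (by fun_prop) fun q => q.2.1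
    refine Continuous.prodMk hbase (continuous_pi fun i => ?_)
    refine (contMDiffOn_ofCoord p).continuousOn.comp_continuous
      (f := fun q : C => ((extChartAt (𝓡∂ n) p).symm q.1.1, q.1.2 i)) (hbase.prodMk ?_)
      fun q => ⟨(extChartAt (𝓡∂ n) p).map_target (hBt q.2.1), mem_univ _⟩
    exact (continuous_apply i).comp (continuous_snd.comp continuous_subtype_val)
  have hsp : Continuous (TangentFrame.span : TangentFrame n N m → TangentPlane n N m) :=
    continuous_coinduced_rng
  have hcomp : IsCompact (range fun q => (F q).span) := isCompact_range (hsp.comp hFc)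
  have := V.regular
  refine lt_of_le_of_lt (measure_mono ?_) hcomp.measure_lt_top
  rintro ⟨x, P, hP⟩ ⟨ξ, hξ, rfl : (extChartAt (𝓡∂ n) p).symm ξ = x⟩
  set S : TangentPlane n N m := ⟨(extChartAt (𝓡∂ n) p).symm ξ, P, hP⟩ with hS
  have hsrc : S.base ∈ (extChartAt (𝓡∂ n) p).source := (extChartAt (𝓡∂ n) p).map_target (hBt hξ)
  have hfr := S.isFrame_basis hsrc
  have hξ' : extChartAt (𝓡∂ n) p S.base = ξ := (extChartAt (𝓡∂ n) p).right_inv (hBt hξ)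
  rw [hξ'] at hfr
  refine ⟨⟨(ξ, fun i => toCoord p S.base (S.basis i)), hξ, hfr⟩, ?_⟩
  have hvec : (fun i => ofCoord p ((extChartAt (𝓡∂ n) p).symm ξ) (toCoord p S.base (S.basis i))) =
      fun i => (S.basis i : TangentSpace (𝓡∂ n) S.base) :=
    funext fun i => ofCoord_toCoord hsrc _
  have hplane : Submodule.span ℝ (range fun i => ofCoord p ((extChartAt (𝓡∂ n) p).symm ξ)
      (toCoord p S.base (S.basis i))) = P := by
    rw [hvec]; exact S.span_basis
  simp only [F, TangentFrame.span, hS, TangentPlane.mk.injEq, true_and]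
  exact hplane

end Finite

section Jacobian

variable {n : ℕ} [NeZero n] {N : Type*} [TopologicalSpace N]
  [ChartedSpace (EuclideanHalfSpace n) N]
  [RiemannianBundle (fun x : N => TangentSpace (𝓡∂ n) x)] {m : ℕ}

theorem jacobian_nonneg (f : N → N) (S : TangentPlane n N m) : 0 ≤ jacobian f S :=
  Real.sqrt_nonneg _

theorem jacobian_id {f : N → N} (hf : ∀ x, f x = x) (S : TangentPlane n N m) :
    jacobian f S = 1 := by
  obtain rfl : f = id := funext hf
  have : Matrix.gram ℝ (fun i => mfderiv (𝓡∂ n) (𝓡∂ n) (id : N → N) S.base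
      (stdOrthonormalBasis ℝ S.plane i : TangentSpace (𝓡∂ n) S.base)) = 1 := by
    ext i j
    rw [Matrix.gram_apply, mfderiv_id, Matrix.one_apply]
    exact orthonormal_iff_ite.1 ((stdOrthonormalBasis ℝ S.plane).orthonormal.comp_linearIsometry
      S.plane.subtypeₗᵢ) i j
  rw [jacobian, this, Matrix.det_one, Real.sqrt_one]

variable [IsManifold (𝓡∂ n) ∞ N]

/-- The Jacobian in the coordinates of the chart at `p`. -/
theorem jacobian_eq_sqrt_det_gramOf {p : N} {f : N → N} {S : TangentPlane n N m}
    (hf : f S.base ∈ (extChartAt (𝓡∂ n) p).source) :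
    jacobian f S = √(gramOf (pullMetric p (extChartAt (𝓡∂ n) p (f S.base))) fun i =>
      toCoord p (f S.base) (mfderiv (𝓡∂ n) (𝓡∂ n) f S.base (S.basis i))).det := by
  have h : (gramOf (pullMetric p (extChartAt (𝓡∂ n) p (f S.base))) fun i =>
      toCoord p (f S.base) (mfderiv (𝓡∂ n) (𝓡∂ n) f S.base (S.basis i))) =
      (Matrix.gram ℝ (fun i => mfderiv (𝓡∂ n) (𝓡∂ n) f S.base
        (stdOrthonormalBasis ℝ S.plane i : TangentSpace (𝓡∂ n) S.base))).submatrix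
        (finCongr S.finrank_eq).symm (finCongr S.finrank_eq).symm := by
    ext i j
    rw [gramOf, Matrix.of_apply, pullMetric_toCoord hf, Matrix.submatrix_apply, Matrix.gram_apply,
      TangentPlane.basis, OrthonormalBasis.reindex_apply, OrthonormalBasis.reindex_apply]
  rw [h, Matrix.det_submatrix_equiv_self, jacobian]

end Jacobian

/-! ### The maximum principle -/

section Flow

variable {n : ℕ} [NeZero n] {N : Type*} [TopologicalSpace N]
  [ChartedSpace (EuclideanHalfSpace n) N] {m : ℕ}

theorem IsFlow.contMDiff {X : ∀ x : N, TangentSpace (𝓡∂ n) x} {φ : ℝ → N → N} (hφ : IsFlow X φ)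
    {t : ℝ} (ht : 0 ≤ t) : ContMDiff (𝓡∂ n) (𝓡∂ n) 1 (φ t) := by
  rw [← contMDiffOn_univ]
  exact hφ.contMDiffOn.comp (f := fun x : N => (t, x))
    (contMDiffOn_const.prodMk contMDiffOn_id) fun x _ => ⟨ht, mem_univ _⟩

/-- A flow keeps a compact set in a given neighbourhood for a short time. -/
theorem IsFlow.exists_forall_mem {X : ∀ x : N, TangentSpace (𝓡∂ n) x} {φ : ℝ → N → N}
    (hφ : IsFlow X φ) {K O : Set N} (hK : IsCompact K) (hO : IsOpen O) (hKO : K ⊆ O) :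
    ∃ T > 0, ∀ t ∈ Icc 0 T, ∀ x ∈ K, φ t x ∈ O := by
  -- extend the flow to negative times by the identity
  have hc : Continuous fun q : ℝ × N => φ (max q.1 0) q.2 := by
    have := hφ.contMDiffOn.continuousOn
    exact this.comp_continuous (f := fun q : ℝ × N => (max q.1 0, q.2)) (by fun_prop)
      fun q => ⟨le_max_right q.1 0, mem_univ _⟩
  obtain ⟨u, v, hu, _, h0u, hKv, huv⟩ := generalized_tube_lemma (isCompact_singleton (x := (0 : ℝ)))
    hK (hO.preimage hc) (by
      rintro ⟨t, x⟩ ⟨ht, hx⟩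
      obtain rfl : t = 0 := ht
      simpa [hφ.zero] using hKO hx)
  obtain ⟨T, hT, hb⟩ := Metric.isOpen_iff.1 hu 0 (h0u rfl)
  refine ⟨T / 2, by positivity, fun t ht x hx => ?_⟩
  have htu : t ∈ u := hb (by
    rw [Metric.mem_ball, Real.dist_eq, sub_zero, abs_of_nonneg ht.1]; linarith [ht.2])
  have h1 : φ (max t 0) x ∈ O := huv (show (t, x) ∈ u ×ˢ v from ⟨htu, hKv hx⟩)
  rwa [max_eq_left ht.1] at h1

variable [IsManifold (𝓡∂ n) ∞ N] [RiemannianBundle (fun x : N => TangentSpace (𝓡∂ n) x)]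
  [IsContMDiffRiemannianBundle (𝓡∂ n) ∞ (EuclideanSpace ℝ (Fin n))
    (fun x : N => TangentSpace (𝓡∂ n) x)]

/-- If the divergence of a coordinate vector field along all `m`-planes is at most `-c` along the
trajectory of `x`, then its flow decreases the area of `m`-planes at `x` at the rate `c`. -/
theorem IsFlow.jacobian_le {p : N} {R r T c : ℝ}
    (hsub : halfBall (extChartAt (𝓡∂ n) p p) R ⊆ (extChartAt (𝓡∂ n) p).target) (hr : r ≤ R)
    {X : EuclideanSpace ℝ (Fin n) → EuclideanSpace ℝ (Fin n)}
    (hXc : ContDiffOn ℝ 1 X (halfBall (extChartAt (𝓡∂ n) p p) R)) {φ : ℝ → N → N}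
    (hφ : IsFlow (chartField p X) φ) (hT : 0 < T)
    (hmaps : ∀ t ∈ Icc 0 T, ∀ x ∈ chartBall (n := n) p r, φ t x ∈ chartBall (n := n) p R)
    {S : TangentPlane n N m} (hS : S.base ∈ chartBall (n := n) p r)
    (hdiv : ∀ t ∈ Icc 0 T, ∀ u : Fin m → EuclideanSpace ℝ (Fin n),
      IsFrame (pullMetric p (extChartAt (𝓡∂ n) p (φ t S.base))) u →
      ∑ i, halfLieDeriv (pullMetric p) (halfBall (extChartAt (𝓡∂ n) p p) R) X
        (extChartAt (𝓡∂ n) p (φ t S.base)) (u i) ≤ -c) :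
    jacobian (φ T) S ≤ Real.exp (-c * T) := by
  set χ := extChartAt (𝓡∂ n) p with hχ
  set U := halfBall (χ p) R with hU
  set s := halfBall (χ p) r with hs
  have hsU : s ⊆ U := halfBall_mono _ hr
  have hst : s ⊆ χ.target := hsU.trans hsub
  have hTT : T ∈ Icc 0 T := ⟨hT.le, le_rfl⟩
  have hsymm : ∀ ξ ∈ s, χ.symm ξ ∈ chartBall (n := n) p r := fun ξ hξ => by
    refine ⟨χ.map_target (hst hξ), ?_⟩
    rw [mem_preimage, ← hχ, χ.right_inv (hst hξ)]
    exact hξ.2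
  set Φ : ℝ → EuclideanSpace ℝ (Fin n) → EuclideanSpace ℝ (Fin n) :=
    fun t ξ => χ (φ t (χ.symm ξ)) with hΦ
  have hΦc : ContDiffOn ℝ 1 (Function.uncurry Φ) (Icc 0 T ×ˢ s) := by
    rw [← contMDiffOn_iff_contDiffOn]
    have h1 : ContMDiffOn 𝓘(ℝ, ℝ × EuclideanSpace ℝ (Fin n)) (𝓘(ℝ, ℝ).prod (𝓡∂ n)) 1
        (fun q : ℝ × EuclideanSpace ℝ (Fin n) => (q.1, χ.symm q.2)) (Icc 0 T ×ˢ s) := by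
      refine ContMDiffOn.prodMk ?_ ?_
      · exact contDiff_fst.contMDiff.contMDiffOn
      · exact (contMDiffOn_extChartAt_symm p).comp contDiff_snd.contMDiff.contMDiffOn
          fun q hq => hst hq.2
    have h2 := hφ.contMDiffOn.comp h1 fun q hq => ⟨hq.1.1, mem_univ _⟩
    exact (contMDiffOn_extChartAt (x := p)).comp h2 fun q hq => by
      have := (hmaps q.1 hq.1 _ (hsymm q.2 hq.2)).1
      rwa [extChartAt_source] at this
  have hΦm : ∀ t ∈ Icc 0 T, MapsTo (Φ t) s U := fun t ht ξ hξ =>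
    extChartAt_mem_halfBall (hmaps t ht _ (hsymm ξ hξ))
  have hΦ0 : ∀ ξ ∈ s, Φ 0 ξ = ξ := fun ξ hξ => by
    simp only [hΦ, hφ.zero]
    exact χ.right_inv (hst hξ)
  have hderχ : ∀ x ∈ χ.source, HasMFDerivAt (𝓡∂ n) 𝓘(ℝ, EuclideanSpace ℝ (Fin n)) χ x
      (toCoord p x) := fun x hx => by
    rw [toCoord_eq_mfderiv hx]
    exact (mdifferentiableAt_extChartAt (by rwa [← extChartAt_source (𝓡∂ n)])).hasMFDerivAt
  have hflow : ∀ ξ ∈ s, ∀ t ∈ Icc 0 T,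
      HasDerivWithinAt (fun t => Φ t ξ) (X (Φ t ξ)) (Icc 0 T) t := by
    intro ξ hξ t ht
    have hsrc := (hmaps t ht _ (hsymm ξ hξ)).1
    have h1 := (hderχ _ hsrc).comp_hasMFDerivWithinAt (s := Icc 0 T) t
      ((hφ.integralCurve (χ.symm ξ) t ht.1).mono Icc_subset_Ici_self)
    have h2 : ((toCoord p (φ t (χ.symm ξ))).comp
        ((1 : ℝ →L[ℝ] ℝ).smulRight (chartField p X (φ t (χ.symm ξ)))) :
        ℝ →L[ℝ] EuclideanSpace ℝ (Fin n)) = (1 : ℝ →L[ℝ] ℝ).smulRight (X (Φ t ξ)) := by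
      refine ContinuousLinearMap.ext fun a => ?_
      have h3 : toCoord p (φ t (χ.symm ξ)) (a • chartField p X (φ t (χ.symm ξ))) =
          a • X (Φ t ξ) := by
        rw [map_smul, chartField, toCoord_ofCoord hsrc]
      exact h3
    have h4 : HasFDerivWithinAt (fun t => Φ t ξ) ((1 : ℝ →L[ℝ] ℝ).smulRight (X (Φ t ξ)))
        (Icc 0 T) t := h2 ▸ hasMFDerivWithinAt_iff_hasFDerivWithinAt.1 h1
    simpa using h4.hasDerivWithinAt
  have hχx : χ S.base ∈ s := extChartAt_mem_halfBall hS
  have hΦx : ∀ t, Φ t (χ S.base) = χ (φ t S.base) := fun t => by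
    simp only [hΦ]; rw [χ.left_inv hS.1]
  have hsrcT := (hmaps T hTT S.base hS).1
  -- the differential of the flow in coordinates
  have hfd : ∀ v : TangentSpace (𝓡∂ n) S.base, fderivWithin ℝ (Φ T) s (χ S.base) (toCoord p S.base v) =
      toCoord p (φ T S.base) (mfderiv (𝓡∂ n) (𝓡∂ n) (φ T) S.base v) := by
    have hd : HasFDerivWithinAt (Φ T) (fderivWithin ℝ (Φ T) s (χ S.base)) s (χ S.base) := by
      have : ContDiffOn ℝ 1 (Φ T) s := hΦc.comp (f := fun ξ => (T, ξ)) (by fun_prop)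
        fun ξ hξ => ⟨hTT, hξ⟩
      exact (this.differentiableOn one_ne_zero _ hχx).hasFDerivWithinAt
    have h1 := hd.hasMFDerivWithinAt.comp S.base ((hderχ S.base hS.1).hasMFDerivWithinAt
      (s := chartBall (n := n) p r)) fun y hy => extChartAt_mem_halfBall hy
    have h2 := h1.hasMFDerivAt ((isOpen_chartBall p r).mem_nhds hS)
    have h3 := (hderχ _ hsrcT).comp S.base
      ((hφ.contMDiff hT.le).mdifferentiable one_ne_zero S.base).hasMFDerivAt
    have heq : (Φ T ∘ χ) =ᶠ[𝓝 S.base] (χ ∘ φ T) := by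
      filter_upwards [(isOpen_chartBall p r).mem_nhds hS] with y hy
      simp only [Function.comp_apply, hΦ]
      rw [χ.left_inv hy.1]
    have h4 := hasMFDerivAt_unique h2 (h3.congr_of_eventuallyEq heq)
    intro v
    exact congrArg (fun L : EuclideanSpace ℝ (Fin n) →L[ℝ] EuclideanSpace ℝ (Fin n) => L v) h4
  have hdet := ((isMetricOn_pullMetric p).mono hsub).det_gramOf_flow_le
    (uniqueDiffOn_halfBall _ _) hXc hT (convex_halfBall _ _) (uniqueDiffOn_halfBall _ _)
    (fun ξ hξ v => exists_add_smul_mem_halfBall hξ v) hΦc hΦm hΦ0 hflow hχx (c := c)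
    (fun t ht u hu => by
      rw [hΦx] at hu ⊢
      exact hdiv t ht u hu) (S.isFrame_basis hS.1)
  rw [jacobian_eq_sqrt_det_gramOf hsrcT]
  rw [Real.sqrt_le_iff]
  refine ⟨(Real.exp_pos _).le, ?_⟩
  rw [← Real.exp_nat_mul]
  rw [hΦx, ← hs] at hdet
  simp only [hfd] at hdet
  convert hdet using 2
  push_cast
  ring

end Flow

section MaximumPrinciple

variable {n : ℕ} [NeZero n] {N : Type*} [TopologicalSpace N]
  [ChartedSpace (EuclideanHalfSpace n) N] [IsManifold (𝓡∂ n) ∞ N] {m : ℕ}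
  [RiemannianBundle (fun x : N => TangentSpace (𝓡∂ n) x)]

/-- If the maps `φ t` decrease area on `W`, and decrease it at the rate `c` on the part of `V` over a
set `B ⊆ W`, then the derivative of the area is at most `-c` times the mass of `V` over `B`. -/
theorem Varifold.deriv_areaImage_le (V : Varifold n N m) {φ : ℝ → N → N} {W B : Set N} {c d T : ℝ}
    (hT : 0 < T) (hφ0 : ∀ x, φ 0 x = x) (hW : IsOpen W) (hB : IsOpen B) (hBW : B ⊆ W)
    (hfin : V.measure {S | S.base ∈ W} < ⊤)
    (hd : HasDerivWithinAt (fun t => V.areaImage (φ t) W) d (Ici 0) 0)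
    (h1 : ∀ t ∈ Ioc 0 T, ∀ S : TangentPlane n N m, S.base ∈ W → jacobian (φ t) S ≤ 1)
    (h2 : ∀ t ∈ Ioc 0 T, ∀ S : TangentPlane n N m, S.base ∈ B →
      jacobian (φ t) S ≤ Real.exp (-c * t)) :
    d ≤ -c * V.measure.real {S | S.base ∈ B} := by
  have hWm : MeasurableSet {S : TangentPlane n N m | S.base ∈ W} :=
    (hW.preimage TangentPlane.continuous_base).measurableSet
  have hBm : MeasurableSet {S : TangentPlane n N m | S.base ∈ B} :=
    (hB.preimage TangentPlane.continuous_base).measurableSet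
  set μ := V.measure.restrict {S | S.base ∈ W} with hμ
  have : IsFiniteMeasure μ := ⟨by rw [hμ, Measure.restrict_apply_univ]; exact hfin⟩
  have hμB : μ.real {S | S.base ∈ B} = V.measure.real {S | S.base ∈ B} := by
    rw [measureReal_def, measureReal_def, hμ, Measure.restrict_apply hBm,
      inter_eq_left.2 (show {S : TangentPlane n N m | S.base ∈ B} ⊆ {S | S.base ∈ W} from
        fun S hS => hBW hS)]
  have harea0 : V.areaImage (φ 0) W = μ.real univ := by
    rw [areaImage, ← hμ]
    simp [jacobian_id hφ0]
  have hle : ∀ t ∈ Ioc 0 T, V.areaImage (φ t) W + (1 - Real.exp (-c * t)) *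
      V.measure.real {S | S.base ∈ B} ≤ V.areaImage (φ 0) W := by
    intro t ht
    set b : TangentPlane n N m → ℝ :=
      {S | S.base ∈ B}.indicator fun _ => 1 - Real.exp (-c * t) with hb
    have hbi : Integrable b μ := (integrable_const _).indicator hBm
    have hmono : V.areaImage (φ t) W ≤ ∫ S, (1 - b S) ∂μ := by
      rw [areaImage, ← hμ]
      refine integral_mono_of_nonneg (Filter.Eventually.of_forall fun S => jacobian_nonneg _ S)
        ((integrable_const _).sub hbi) ?_
      filter_upwards [ae_restrict_mem hWm] with S hS
      by_cases hSB : S.base ∈ B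
      · have : b S = 1 - Real.exp (-c * t) := indicator_of_mem (s := {S : TangentPlane n N m | S.base ∈ B}) hSB _
        rw [this]
        linarith [h2 t ht S hSB]
      · have : b S = 0 := indicator_of_notMem (s := {S : TangentPlane n N m | S.base ∈ B}) hSB _
        rw [this]
        linarith [h1 t ht S hS]
    rw [integral_sub (integrable_const _) hbi, hb, integral_indicator_const _ hBm, hμB] at hmono
    simp only [integral_const, smul_eq_mul, mul_one] at hmono
    rw [harea0]
    linarith
  have hexp : HasDerivWithinAt (fun t : ℝ => (1 - Real.exp (-c * t)) *
      V.measure.real {S | S.base ∈ B}) (c * V.measure.real {S | S.base ∈ B}) (Ici 0) 0 := by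
    have h := ((((hasDerivAt_id (0 : ℝ)).const_mul (-c)).exp).const_sub 1).mul_const
      (V.measure.real {S : TangentPlane n N m | S.base ∈ B})
    simpa using h.hasDerivWithinAt
  have hmax : IsLocalMaxOn (fun t => V.areaImage (φ t) W + (1 - Real.exp (-c * t)) *
      V.measure.real {S | S.base ∈ B}) (Ici 0) 0 := by
    filter_upwards [inter_mem_nhdsWithin (Ici (0 : ℝ)) (Iic_mem_nhds hT)] with t ht
    rcases eq_or_lt_of_le (show (0 : ℝ) ≤ t from ht.1) with rfl | h
    · exact le_rfl
    · simpa using hle t ⟨h, ht.2⟩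
  have hsum := hmax.hasFDerivWithinAt_nonpos (hd.add hexp).hasFDerivWithinAt
    (y := 1) (mem_posTangentConeAt_of_segment_subset (by
      rw [zero_add, segment_eq_Icc zero_le_one]; exact Icc_subset_Ici_self))
  simp at hsum
  linarith

end MaximumPrinciple

/-- The uniform bound for varifolds that minimize area to first order: their supports stay away from
a point of strong convexity of the boundary. -/
theorem exists_le_infEDist_spt (n : ℕ) [NeZero n] (m : ℕ)
    (N : Type*) [EMetricSpace N]
    [ChartedSpace (EuclideanHalfSpace n) N] [IsManifold (𝓡∂ n) ∞ N]
    [RiemannianBundle (fun x : N => TangentSpace (𝓡∂ n) x)]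
    [IsContMDiffRiemannianBundle (𝓡∂ n) ∞ (EuclideanSpace ℝ (Fin n))
      (fun x : N => TangentSpace (𝓡∂ n) x)]
    [MeasurableSpace N] [BorelSpace N]
    (p : N) (hp : p ∈ (𝓡∂ n).boundary N) (hconv : StronglyConvexAt (n := n) m p) :
    ∃ ε : ℝ, 0 < ε ∧ ∀ V : Varifold n N m, V.MinimizesAreaToFirstOrder →
      ENNReal.ofReal ε ≤ Metric.infEDist p V.spt := by
  obtain ⟨R, hR, hsub⟩ := exists_halfBall_subset_target (n := n) p
  set ℓ : EuclideanSpace ℝ (Fin n) →L[ℝ] ℝ := EuclideanSpace.proj (0 : Fin n) with hℓ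
  have hℓ0 : ℓ ≠ 0 := fun h => by
    have := congrArg (fun L : EuclideanSpace ℝ (Fin n) →L[ℝ] ℝ => L (EuclideanSpace.single 0 1)) h
    simp [hℓ] at this
  obtain ⟨X, r, hr, c, hc, r₀, hr₀, hrR, hXc, hXs, hX0, hdiv⟩ :=
    ((isMetricOn_pullMetric p).mono hsub).exists_contracting_field (ℓ := ℓ) (m := m)
    (uniqueDiffOn_halfBall _ _) (half_pos hR)
    (fun ξ h0 hd => ⟨h0, Metric.mem_ball.2 (by linarith)⟩) (fun ξ hξ => hξ.1)
    (extChartAt_zero_eq_zero (mem_extChartAt_source p) hp) hℓ0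
    (fun u hu hu0 => sum_christoffelOn_pos hconv hR hsub hu hu0)
  have hadm : IsAdmissible (n := n) (chartField p X) :=
    isAdmissible_chartField hsub (by linarith) hXc hXs hX0
  -- the field contracts the planes over `B` at the rate `c`
  set r₁ := min (r₀ / 2) r with hr₁
  have hr₁0 : 0 < r₁ := lt_min (by linarith) hr
  have hr₁r : r₁ ≤ r := min_le_right _ _
  have hr₁r₀ : r₁ < r₀ := (min_le_left _ _).trans_lt (by linarith)
  set B := chartBall (n := n) p r₁ with hB
  obtain ⟨ε, hε, hεB⟩ : ∃ ε : ℝ, 0 < ε ∧ ∀ y, edist p y < ENNReal.ofReal ε → y ∈ B := by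
    obtain ⟨ε, hε, hsubB⟩ := EMetric.mem_nhds_iff.1
      ((isOpen_chartBall (n := n) p r₁).mem_nhds (mem_chartBall_self p hr₁0))
    obtain ⟨δ, hδ, hδε⟩ := ENNReal.lt_iff_exists_real_btwn.1 hε
    refine ⟨δ, ENNReal.ofReal_pos.1 hδε.1, fun y hy => hsubB ?_⟩
    rw [Metric.mem_eball, edist_comm]
    exact hy.trans hδε.2
  refine ⟨ε, hε, fun V hV => ?_⟩
  by_contra hlt
  rw [not_le] at hlt
  obtain ⟨y, hy, hpy⟩ := Metric.infEDist_lt_iff.1 hlt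
  have hBpos : 0 < V.measure {S | S.base ∈ B} := by
    have h1 := (Measure.mem_support_iff_forall y).1 hy _ ((isOpen_chartBall p r₁).mem_nhds (hεB y hpy))
    rwa [Varifold.weight, Measure.map_apply TangentPlane.continuous_base.measurable
      (isOpen_chartBall p r₁).measurableSet] at h1
  obtain ⟨d, ⟨φ, hφ, hder⟩, hd⟩ := hV _ hadm
  set W := chartBall (n := n) p (2 * r) with hW
  have hBW : B ⊆ W := fun x hx => ⟨hx.1, Metric.ball_subset_ball (by linarith) hx.2⟩
  have h2r : IsCompact (chartClosedBall (n := n) p (2 * r)) :=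
    isCompact_chartClosedBall hsub (by linarith)
  have hWc := chartBall_subset_chartClosedBall (n := n) p (2 * r)
  have hclW : IsCompact (closure W) :=
    h2r.of_isClosed_subset isClosed_closure (closure_minimal hWc h2r.isClosed)
  have hsuppW : closure {x : N | chartField p X x ≠ 0} ⊆ W :=
    (closure_minimal (support_chartField_subset hXs)
      (isCompact_chartClosedBall hsub (by linarith)).isClosed).trans
      (chartClosedBall_subset_chartBall hsub (by linarith) (by linarith))
  have hderW := hder W (isOpen_chartBall p _) hclW hsuppW
  have hfin : V.measure {S | S.base ∈ W} < ⊤ :=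
    (measure_mono (show {S : TangentPlane n N m | S.base ∈ W} ⊆ _ from fun S hS => hWc hS)).trans_lt
      (V.measure_chartClosedBall_lt_top hsub (show 2 * r < R by linarith))
  -- for a short time the flow maps `W` into the ball of radius `3r`, and `B` into that of radius `r₀`
  obtain ⟨T₁, hT₁, hmap₁⟩ := hφ.exists_forall_mem h2r (isOpen_chartBall (n := n) p (3 * r))
    (chartClosedBall_subset_chartBall hsub (by linarith) (by linarith))
  obtain ⟨T₂, hT₂, hmap₂⟩ := hφ.exists_forall_mem
    (isCompact_chartClosedBall hsub (show r₁ < R by linarith))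
    (isOpen_chartBall (n := n) p r₀)
    (chartClosedBall_subset_chartBall hsub (by linarith) hr₁r₀)
  have h3R : ∀ x ∈ chartBall (n := n) p (3 * r), x ∈ chartBall (n := n) p R := fun x hx =>
    ⟨hx.1, Metric.ball_subset_ball (by linarith) hx.2⟩
  have hle := V.deriv_areaImage_le (c := c) (lt_min hT₁ hT₂) hφ.zero (isOpen_chartBall p _)
    (isOpen_chartBall p _) hBW hfin hderW
    (fun t ht S hS => by
      have htT : Icc 0 t ⊆ Icc 0 T₁ := Icc_subset_Icc_right (ht.2.trans (min_le_left _ _))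
      have h := hφ.jacobian_le hsub (show 2 * r ≤ R by linarith) hXc ht.1 (c := 0)
        (fun τ hτ x hx => h3R _ (hmap₁ τ (htT hτ) x (hWc hx))) hS fun τ hτ u hu => by
          have h3 := hmap₁ τ (htT hτ) _ (hWc hS)
          simpa using (hdiv _ (extChartAt_mem_halfBall (h3R _ h3)) h3.2 u hu).1
      simpa using h)
    (fun t ht S hS => by
      have htT : Icc 0 t ⊆ Icc 0 T₁ := Icc_subset_Icc_right (ht.2.trans (min_le_left _ _))
      have htT₂ : Icc 0 t ⊆ Icc 0 T₂ := Icc_subset_Icc_right (ht.2.trans (min_le_right _ _))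
      refine hφ.jacobian_le hsub (show 2 * r ≤ R by linarith) hXc ht.1
        (fun τ hτ x hx => h3R _ (hmap₁ τ (htT hτ) x (hWc hx))) (hBW hS) fun τ hτ u hu => ?_
      have h3 := hmap₁ τ (htT hτ) _ (hWc (hBW hS))
      have h4 := hmap₂ τ (htT₂ hτ) _ (chartBall_subset_chartClosedBall p _ hS)
      exact (hdiv _ (extChartAt_mem_halfBall (h3R _ h3)) h3.2 u hu).2 h4.2)
  have hBfin : V.measure {S | S.base ∈ B} ≠ ⊤ :=
    ((measure_mono (show {S : TangentPlane n N m | S.base ∈ B} ⊆ _ from fun S hS => hBW hS)).trans_lt hfin).ne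
  have hpos : 0 < V.measure.real {S | S.base ∈ B} := ENNReal.toReal_pos hBpos.ne' hBfin
  nlinarith

end MinVarifold

end

theorem theorem1 (n : ℕ) [NeZero n] (m : ℕ)
    (N : Type*) [EMetricSpace N] [SecondCountableTopology N]
    [ChartedSpace (EuclideanHalfSpace n) N] [IsManifold (𝓡∂ n) ∞ N]
    [RiemannianBundle (fun x : N => TangentSpace (𝓡∂ n) x)]
    [IsContMDiffRiemannianBundle (𝓡∂ n) ∞ (EuclideanSpace ℝ (Fin n))
      (fun x : N => TangentSpace (𝓡∂ n) x)]
    [IsRiemannianManifold (𝓡∂ n) N]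
    [MeasurableSpace N] [BorelSpace N]
    (p : N) (hp : p ∈ (𝓡∂ n).boundary N) (hconv : MinVarifold.StronglyConvexAt (n := n) m p) :
    (∀ V : MinVarifold.Varifold n N m, V.MinimizesAreaToFirstOrder → p ∉ V.spt) ∧
    ∃ ε : ℝ, 0 < ε ∧ ∀ V : MinVarifold.Varifold n N m, V.MinimizesAreaToFirstOrder →
      ENNReal.ofReal ε ≤ Metric.infEDist p V.spt := by
  obtain ⟨ε, hε, h⟩ := MinVarifold.exists_le_infEDist_spt n m N p hp hconv
  refine ⟨fun V hV hmem => ?_, ε, hε, h⟩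
  have h0 := h V hV
  rw [Metric.infEDist_zero_of_mem hmem] at h0
  exact absurd h0 (not_le.2 (ENNReal.ofReal_pos.2 hε))
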